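/- Let $d\in\{2,3\}$ and $\gamma_0\in\mathbb R$. There is a constant $C>0$, depending only on $d$ and $\gamma_0$, such that the following holds. **Setting.** Let $D\subset\mathbb R^d$ be a bounded Lipschitz domain, and let $\mathcal T_h$ be a conforming triangulation of $\overline D$ into finitely many nondegenerate $d$-simplices $T$ with $h_T/\rho_T\le\gamma_0$, where $h_T=\operatorname{diam}(T)$ and $\rho_T$ is the radius of the largest closed ball contained in $\overline T$. Let $\mathcal E$ be the set of all faces of the simplices, $\mathcal E_D$ the set of faces contained in $\partial D$, and $\mathcal E_I=\mathcal E\setminus\mathcal E_D$. Let $(\Omega,\mathcal A,P)$ be a probability space. For almost every $\omega\in\Omega$ let $a_\omega$ be continuous on $\overline D$ with $a_{\min}(\omega):=\min_{\overline D}a_\omega>0$, and let $\vec g_\omega\in L^2(D)^d$, $f_\omega\in L^2(D)$; let $u_\Gamma\in H^{1/2}(\partial D)$ (the space of traces of $H^1(D)$ functions). *Continuous problem.* For almost every $\omega$, let $(\vec q_\omega,u_\omega)\in H(\mathrm{div},D)\times L^2(D)$ satisfy $$(a_\omega^{-1}\vec q_\omega,\vec v)_{L^2(D)}-(\operatorname{div}\vec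 v,u_\omega)_{L^2(D)}=(\vec g_\omega,\vec v)_{L^2(D)}-\int_{\partial D}u_\Gamma\,\vec v\cdot\vec\nu\,ds\quad\forall\,\vec v\in H(\mathrm{div},D),$$ $$-(\operatorname{div}\vec q_\omega,w)_{L^2(D)}=-(f_\omega,w)_{L^2(D)}\quad\forall\,w\in L^2(D),$$ where the boundary integral denotes the $H^{-1/2}$–$H^{1/2}$ duality pairing. *Hybridised lowest order Raviart–Thomas discretisation.* Let $RT_{-1}(\mathcal T_h)$ be the space of all $\vec v$ with $\vec v|_T(\vec x)=\vec\alpha_T+\beta_T\vec x$ ($\vec\alpha_T\in\mathbb R^d$, $\beta_T\in\mathbb R$) for every $T$, without continuity between elements; let $\mathcal W_h$ be the space of piecewise constant functions on $\mathcal T_h$, let $M_{-1}(\mathcal E)$ be the space of functions on the skeleton that are constant on each face, and $M_{-1}(\mathcal E_I)$ the subspace of those that vanish on the faces in $\mathcal E_D$. Let $\vec\nu_T$ be the outward unit normal of $T$. For almost every $\omega$, let $(\vec q_{h,\omega},u_{h,\omega},\lambda_{h,\omega})\in RT_{-1}(\mathcal T_h)\times\mathcal W_h\times M_{-1}(\mathcal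 E_I)$ satisfy, for all $\vec v_h\in RT_{-1}(\mathcal T_h)$, $w_h\in\mathcal W_h$, $\mu_h\in M_{-1}(\mathcal E_I)$, $$\sum_T\Big[(a_\omega^{-1}\vec q_{h,\omega},\vec v_h)_{L^2(T)}-(\operatorname{div}\vec v_h,u_{h,\omega})_{L^2(T)}+\sum_{E\subset\partial T,\,E\in\mathcal E_I}(\lambda_{h,\omega},\vec v_h|_T\cdot\vec\nu_T)_{L^2(E)}\Big]=\sum_T\Big[(\vec g_\omega,\vec v_h)_{L^2(T)}-\sum_{E\subset\partial T,\,E\in\mathcal E_D}(u_\Gamma,\vec v_h|_T\cdot\vec\nu_T)_{L^2(E)}\Big],$$ $$-\sum_T(\operatorname{div}\vec q_{h,\omega},w_h)_{L^2(T)}=-\sum_T(f_\omega,w_h)_{L^2(T)},\qquad\sum_T\sum_{E\subset\partial T,\,E\in\mathcal E_I}(\mu_h,\vec q_{h,\omega}|_T\cdot\vec\nu_T)_{L^2(E)}=0.$$ *Projections.* Let $P_h$ be the $L^2(D)$-orthogonal projection onto $\mathcal W_h$, and let $P_h^{\mathcal E}$ be the orthogonal projection of $L^2(\mathcal E)=\bigoplus_{E\in\mathcal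 E}L^2(E)$ onto $M_{-1}(\mathcal E)$ with respect to $\sum_{E\in\mathcal E}(\cdot,\cdot)_{L^2(E)}$. **Claim.** For almost every $\omega$, $u_\omega\in H^1(D)$ and it has a trace $u_\omega|_{\mathcal E}\in L^2(\mathcal E)$ on the skeleton; and for every element $T\in\mathcal T_h$ and every face $E$ of $T$ which is an interior face, or on which $u_\Gamma=0$ almost everywhere (so for every face of $T$ if $u_\Gamma=0$), $$\|\lambda_{h,\omega}-P_h^{\mathcal E}u_\omega\|_{L^2(E)}\le C\Big(\frac1{a_{\min}(\omega)}\,h_T^{1/2}\,\|\vec q_\omega-\vec q_{h,\omega}\|_{L^2(T)}+h_T^{-1/2}\,\|u_{h,\omega}-P_hu_\omega\|_{L^2(T)}\Big).$$ -/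

import Mathlib

open MeasureTheory Filter Topology
open scoped ENNReal NNReal Classical

noncomputable section

namespace MixedFEM

/-- The Euclidean space `ℝ^d`. -/
abbrev Pt (d : ℕ) : Type := EuclideanSpace ℝ (Fin d)

variable {d : ℕ}

/-- The `(d-1)`-dimensional surface measure on `ℝ^d`: the Hausdorff measure, normalised so that it
is the `(d-1)`-dimensional Lebesgue measure on hyperplanes. -/
def surf (d : ℕ) : Measure (Pt d) := μHE[d - 1]

/-- The `L²(S)`-norm with respect to the measure `μ`. -/
def normL2 {F : Type*} [NormedAddCommGroup F] (μ : Measure (Pt d)) (S : Set (Pt d))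
    (f : Pt d → F) : ℝ :=
  (eLpNorm f 2 (μ.restrict S)).toReal

/-! ### Domains and Sobolev-type spaces -/

/-- A bounded Lipschitz domain: near each boundary point, the domain is the region above the graph
of a Lipschitz function `φ` of the coordinates orthogonal to some unit vector `e`
(a function of these coordinates is a function on `ℝ^d` that is invariant in direction `e`). -/
structure IsLipschitzDomain (D : Set (Pt d)) : Prop where
  isOpen : IsOpen D
  isConnected : IsConnected D
  isBounded : Bornology.IsBounded D
  graph : ∀ x ∈ frontier D, ∃ r > 0, ∃ e : Pt d, ‖e‖ = 1 ∧ ∃ (K : ℝ≥0) (φ : Pt d → ℝ),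
    LipschitzWith K φ ∧ (∀ (y : Pt d) (t : ℝ), φ (y + t • e) = φ y) ∧
      ∀ y ∈ Metric.ball x r, (y ∈ D ↔ φ y < inner ℝ e y)

/-- Test functions: the elements of `C_c^∞(D)`. -/
structure IsTestFunction (D : Set (Pt d)) (φ : Pt d → ℝ) : Prop where
  smooth : ContDiff ℝ (⊤ : ℕ∞) φ
  compact : HasCompactSupport φ
  subset : tsupport φ ⊆ D

/-- `u ∈ L²(D)`. -/
def MemL2 {F : Type*} [NormedAddCommGroup F] (D : Set (Pt d)) (u : Pt d → F) : Prop :=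
  MemLp u 2 (volume.restrict D)

/-- `u ∈ H¹(D)` with weak gradient `G`. -/
structure MemH1 (D : Set (Pt d)) (u : Pt d → ℝ) (G : Pt d → Pt d) : Prop where
  memL2 : MemL2 D u
  grad_memL2 : MemL2 D G
  weak : ∀ φ, IsTestFunction D φ → ∀ e : Pt d,
    ∫ x in D, u x * fderiv ℝ φ x e = -∫ x in D, inner ℝ (G x) e * φ x

/-- `v ∈ H(div, D)` with weak divergence `w`. -/
structure MemHdiv (D : Set (Pt d)) (v : Pt d → Pt d) (w : Pt d → ℝ) : Prop where
  memL2 : MemL2 D v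
  div_memL2 : MemL2 D w
  weak : ∀ φ, IsTestFunction D φ →
    ∫ x in D, fderiv ℝ φ x (v x) = -∫ x in D, w x * φ x

/-- `γ ∈ L²(Γ)` is the trace on the hypersurface `Γ` (a subset of the closure of `D`) of
`u ∈ H¹(D)`: some functions `φ n`, smooth up to the boundary, tend to `u` in `H¹(D)` while their
restrictions to `Γ` tend to `γ` in `L²(Γ)`. -/
def HasTrace (D Γ : Set (Pt d)) (u γ : Pt d → ℝ) : Prop :=
  MemLp γ 2 ((surf d).restrict Γ) ∧ ∃ G, MemH1 D u G ∧
    ∃ φ : ℕ → Pt d → ℝ, (∀ n, ContDiff ℝ (⊤ : ℕ∞) (φ n)) ∧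
      Tendsto (fun n => eLpNorm (fun x => φ n x - u x) 2 (volume.restrict D)) atTop (𝓝 0) ∧
      Tendsto (fun n => eLpNorm (fun x => gradient (φ n) x - G x) 2 (volume.restrict D))
        atTop (𝓝 0) ∧
      Tendsto (fun n => eLpNorm (fun x => φ n x - γ x) 2 ((surf d).restrict Γ)) atTop (𝓝 0)

/-- The minimum over the closure of `D` of a continuous positive coefficient. -/
def aMin (D : Set (Pt d)) (a : Pt d → ℝ) : ℝ := sInf (a '' closure D)

/-! ### The mixed problem -/

/-- `(q, u) ∈ H(div, D) × L²(D)` solves the mixed weak form of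
`a⁻¹ q + ∇ u = g`, `div q = f` in `D`, `u = uΓ` on the boundary:
`(a⁻¹ q, v) - (div v, u) = (g, v) - ∫_{∂D} uΓ v·ν` for all `v ∈ H(div, D)`, and
`-(div q, w) = -(f, w)` for all `w ∈ L²(D)`.
The boundary term is the duality pairing of the normal trace of `v` with `uΓ ∈ H^{1/2}(∂D)`; it is
`∫_D U div v + ∇U·v` for any `U ∈ H¹(D)` with trace `uΓ`. -/
structure IsMixedSolution (D : Set (Pt d)) (a : Pt d → ℝ) (g : Pt d → Pt d) (f uΓ : Pt d → ℝ)
    (q : Pt d → Pt d) (u : Pt d → ℝ) : Prop where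
  u_memL2 : MemL2 D u
  first : ∃ U GU, MemH1 D U GU ∧ HasTrace D (frontier D) U uΓ ∧
    ∀ v dv, MemHdiv D v dv →
      (∫ x in D, (a x)⁻¹ * inner ℝ (q x) (v x)) - ∫ x in D, dv x * u x =
        (∫ x in D, inner ℝ (g x) (v x)) - ∫ x in D, (U x * dv x + inner ℝ (GU x) (v x))
  second : ∃ dq, MemHdiv D q dq ∧
    ∀ w, MemL2 D w → -∫ x in D, dq x * w x = -∫ x in D, f x * w x

/-! ### Triangulations -/

/-- A conforming triangulation of (the closure of) `D` into finitely many nondegenerate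
`d`-simplices, each given by its set of `d + 1` vertices. -/
structure Triangulation (D : Set (Pt d)) where
  cells : Finset (Finset (Pt d))
  card_eq : ∀ T ∈ cells, T.card = d + 1
  indep : ∀ T ∈ cells, AffineIndependent ℝ ((↑) : T → Pt d)
  conforming : ∀ T ∈ cells, ∀ T' ∈ cells,
    convexHull ℝ (T : Set (Pt d)) ∩ convexHull ℝ (T' : Set (Pt d)) ⊆
      convexHull ℝ ((T : Set (Pt d)) ∩ (T' : Set (Pt d)))
  cover : ⋃ T ∈ cells, convexHull ℝ (T : Set (Pt d)) = closure D

/-- The closed simplex spanned by a finite set of vertices. -/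
def hull (T : Finset (Pt d)) : Set (Pt d) := convexHull ℝ (T : Set (Pt d))

/-- The open element with vertex set `T`. -/
def elt (T : Finset (Pt d)) : Set (Pt d) := interior (hull T)

/-- The faces of the element `T`. -/
def facesOf (T : Finset (Pt d)) : Finset (Finset (Pt d)) := T.powersetCard d

/-- The set of all faces of the triangulation. -/
def Triangulation.faces {D : Set (Pt d)} (𝒯 : Triangulation D) : Finset (Finset (Pt d)) :=
  𝒯.cells.biUnion facesOf

/-- `E` is a boundary face; the other faces are the interior ones. -/
def IsBoundaryFace (D : Set (Pt d)) (E : Finset (Pt d)) : Prop := hull E ⊆ frontier D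

/-- The interior faces of the element `T`. -/
def interiorFacesOf (D : Set (Pt d)) (T : Finset (Pt d)) : Finset (Finset (Pt d)) :=
  (facesOf T).filter fun E => ¬ IsBoundaryFace D E

/-- The boundary faces of the element `T`. -/
def boundaryFacesOf (D : Set (Pt d)) (T : Finset (Pt d)) : Finset (Finset (Pt d)) :=
  (facesOf T).filter fun E => IsBoundaryFace D E

/-- The element diameter. -/
def diamT (T : Finset (Pt d)) : ℝ := Metric.diam (elt T)

/-- The radius of the largest closed ball contained in the closed simplex. -/
def inradius (T : Finset (Pt d)) : ℝ :=
  sSup {r : ℝ | 0 ≤ r ∧ ∃ x, Metric.closedBall x r ⊆ hull T}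

/-- Nondegeneracy with constant `γ₀`. -/
def Triangulation.IsShapeRegular {D : Set (Pt d)} (𝒯 : Triangulation D) (γ₀ : ℝ) : Prop :=
  ∀ T ∈ 𝒯.cells, diamT T / inradius T ≤ γ₀

/-- `n` is the unit normal of the face `E` of the element `T` that points out of `T`. -/
structure IsOutwardNormal (T E : Finset (Pt d)) (n : Pt d) : Prop where
  unit : ‖n‖ = 1
  orth : ∀ x ∈ E, ∀ y ∈ E, inner ℝ n (x - y) = 0
  out : ∀ p ∈ T, p ∉ E → ∀ x ∈ E, inner ℝ n (p - x) < 0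

/-- The outward unit normal of the face `E` of the element `T`. -/
def outwardNormal (T E : Finset (Pt d)) : Pt d := Classical.epsilon (IsOutwardNormal T E)

/-! ### The hybridised discrete problem

Functions that are defined separately on each element, without continuity between elements, are
families indexed by the elements; functions that are constant on each face are families of numbers
indexed by the faces. -/

/-- Lowest order Raviart-Thomas shape functions `v(x) = α + β x`. -/
def IsRT0 (v : Pt d → Pt d) : Prop := ∃ (α : Pt d) (β : ℝ), ∀ x, v x = α + β • x

/-- The classical divergence. -/
def divergence (v : Pt d → Pt d) (x : Pt d) : ℝ :=
  ∑ i, (fderiv ℝ v x (EuclideanSpace.single i 1)) i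

/-- `(qh, uh, lam)` solves the hybridised mixed system: `qh` is discontinuous piecewise `RT₀`, `uh`
is piecewise constant, `lam` is constant on each face and vanishes on boundary faces. The multiplier
terms sum, over the elements `T`, the normal components on the interior faces of `T` of the
restrictions to `T`, with the normal outward from `T`; so each interior face carries the jump of the
normal component across it. -/
structure IsHybridSolution {D : Set (Pt d)} (𝒯 : Triangulation D) (a : Pt d → ℝ)
    (g : Pt d → Pt d) (f uΓ : Pt d → ℝ) (qh : Finset (Pt d) → Pt d → Pt d)
    (uh : Finset (Pt d) → ℝ) (lam : Finset (Pt d) → ℝ) : Prop where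
  rt : ∀ T ∈ 𝒯.cells, IsRT0 (qh T)
  lam_boundary : ∀ E ∈ 𝒯.faces, IsBoundaryFace D E → lam E = 0
  first : ∀ v : Finset (Pt d) → Pt d → Pt d, (∀ T ∈ 𝒯.cells, IsRT0 (v T)) →
    ∑ T ∈ 𝒯.cells, (∫ x in elt T, (a x)⁻¹ * inner ℝ (qh T x) (v T x)) +
        ∑ T ∈ 𝒯.cells, (-∫ x in elt T, divergence (v T) x * uh T) +
        ∑ T ∈ 𝒯.cells, ∑ E ∈ interiorFacesOf D T,
          (∫ x in hull E, lam E * inner ℝ (v T x) (outwardNormal T E) ∂(surf d)) =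
      ∑ T ∈ 𝒯.cells, (∫ x in elt T, inner ℝ (g x) (v T x)) -
        ∑ T ∈ 𝒯.cells, ∑ E ∈ boundaryFacesOf D T,
          (∫ x in hull E, uΓ x * inner ℝ (v T x) (outwardNormal T E) ∂(surf d))
  second : ∀ w : Finset (Pt d) → ℝ,
    ∑ T ∈ 𝒯.cells, (-∫ x in elt T, divergence (qh T) x * w T) =
      -∑ T ∈ 𝒯.cells, (∫ x in elt T, f x * w T)
  third : ∀ μ : Finset (Pt d) → ℝ,
    ∑ T ∈ 𝒯.cells, ∑ E ∈ interiorFacesOf D T,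
      (∫ x in hull E, μ E * inner ℝ (qh T x) (outwardNormal T E) ∂(surf d)) = 0

/-! ### Traces on the skeleton and orthogonal projections -/

/-- `γ = (γ E)_E ∈ L²(𝓔)`, the direct sum of the `L²(E)` over all faces, is the trace of
`u ∈ H¹(D)` on the skeleton. -/
def Triangulation.IsSkeletonTrace {D : Set (Pt d)} (𝒯 : Triangulation D) (u : Pt d → ℝ)
    (γ : Finset (Pt d) → Pt d → ℝ) : Prop :=
  ∀ E ∈ 𝒯.faces, HasTrace D (hull E) u (γ E)

/-- `Pu` is the `L²(D)`-orthogonal projection of `u` onto the piecewise constant functions. -/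
def Triangulation.IsCellProjection {D : Set (Pt d)} (𝒯 : Triangulation D) (u : Pt d → ℝ)
    (Pu : Finset (Pt d) → ℝ) : Prop :=
  ∀ w : Finset (Pt d) → ℝ, ∑ T ∈ 𝒯.cells, (∫ x in elt T, (u x - Pu T) * w T) = 0

/-- `Pγ` is the orthogonal projection of `γ ∈ L²(𝓔)` onto the functions that are constant on each
face, for the inner product `∑_E (·, ·)_{L²(E)}`. -/
def Triangulation.IsFaceProjection {D : Set (Pt d)} (𝒯 : Triangulation D)
    (γ : Finset (Pt d) → Pt d → ℝ) (Pγ : Finset (Pt d) → ℝ) : Prop :=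
  ∀ μ : Finset (Pt d) → ℝ,
    ∑ E ∈ 𝒯.faces, (∫ x in hull E, (γ E x - Pγ E) * μ E ∂(surf d)) = 0

end MixedFEM

end

open MixedFEM

open MixedFEM

namespace MixedFEM

variable {d : ℕ}

open scoped Pointwise InnerProductSpace RealInnerProductSpace Convolution

/-! ### Integration over cones -/

/-! Fix an element `T`, a face `E` of it, the opposite vertex `p` and the height `h` of `p` over
`E`. The field `x - p` is, up to a factor, the Raviart-Thomas basis field of `E`: its divergence is
`d`, its normal component is `h` on `E` and zero on every other face of `T`, because these contain
`p`. Used as test field on `T` alone, it isolates the single multiplier value on `E` in the first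
discrete equation (`IsHybridSolution.local_identity`); the boundary datum drops out since `E` is
interior or the datum vanishes on it.

On the continuous side `u` is in `H¹` with gradient `g - a⁻¹ q`, and the Green formula on `T` with
the same field (`IsOpposite.green_of_hasTrace`) gives the same relation for the mean of the trace on
`E`. Subtracting cancels `g` and leaves `multiplier_identity`: `h |E| (λ - P u) = ∫_T a⁻¹ (q -
q_h)·(x - p) + d |T| (u_h - P u)`. The Green formula for `ψ = 1` says `d |T| = h |E|`.
Cauchy-Schwarz, `|x - p| ≤ h_T` and shape regularity in the form `h_T ≤ max γ₀ 1 * h` then give the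
estimate with the constant `√(d * max γ₀ 1)`.

The Green formula needs no general divergence theorem: `T` is a cone over `E` with apex `p`, and
along each ray from `p` the integrand is an exact derivative (`green_cone`).

Traces are limits of smooth functions on the whole space, so `u` must be approximated by such
functions. No density theorem for Lipschitz domains is required. The datum comes with an `H¹`
function `U` that is already such a limit. The mixed equation holds for test fields that are free on
the boundary, so the extension of `u - U` by zero has a weak gradient on the whole space and can be
mollified. The trace inequality, which is the Green formula for `ψ²`, makes the restrictions to a
face Cauchy. -/

/-- Coordinates adapted to the hyperplanes orthogonal to a unit vector `n`. -/
noncomputable def sliceEquiv (p : Pt d) {n : Pt d} (hn : ‖n‖ = 1) :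
    ℝ × (ℝ ∙ n)ᗮ ≃ᵐ Pt d :=
  (MeasurableEquiv.prodCongr
    (LinearIsometryEquiv.toSpanUnitSingleton n hn).toHomeomorph.toMeasurableEquiv
    (MeasurableEquiv.refl _)).trans ((ℝ ∙ n).measurableEquivProd p).symm

lemma sliceEquiv_apply (p : Pt d) {n : Pt d} (hn : ‖n‖ = 1) (z : ℝ × (ℝ ∙ n)ᗮ) :
    sliceEquiv p hn z = z.1 • n + (z.2 : Pt d) + p := by
  simp only [sliceEquiv, MeasurableEquiv.trans_apply, Submodule.measurableEquivProd_symm_apply]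
  rfl

lemma measurePreserving_sliceEquiv (p : Pt d) {n : Pt d} (hn : ‖n‖ = 1) :
    MeasurePreserving (sliceEquiv p hn) (volume.prod volume) volume := by
  have h1 := ((ℝ ∙ n).measurePreserving_measurableEquivProd p).symm
  rw [InnerProductSpace.euclideanHausdorffMeasure_eq_volume] at h1
  refine MeasurePreserving.trans ?_ h1
  exact ((LinearIsometryEquiv.toSpanUnitSingleton n hn).measurePreserving).prod
    (MeasurePreserving.id _)

lemma finrank_orthogonal_unit (hd : 1 ≤ d) {n : Pt d} (hn : ‖n‖ = 1) :
    Module.finrank ℝ (ℝ ∙ n)ᗮ = d - 1 := by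
  have : Fact (Module.finrank ℝ (Pt d) = (d - 1) + 1) := ⟨by simp; omega⟩
  exact Submodule.finrank_orthogonal_span_singleton (by intro h; simp [h] at hn)

/-- The section at height `h` of a set, as a subset of the orthogonal hyperplane. -/
def slice (p n : Pt d) (h : ℝ) (E : Set (Pt d)) : Set (ℝ ∙ n)ᗮ :=
  {w | h • n + (w : Pt d) + p ∈ E}

/-- The parametrisation of the hyperplane by `n^⊥` is an isometry, and on `n^⊥` the normalised
Hausdorff measure of dimension `d - 1` is Lebesgue measure. Surface integrals over `E` thereby
become volume integrals in `n^⊥`. -/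
lemma surf_restrict_eq_map (hd : 1 ≤ d) {p n : Pt d} (hn : ‖n‖ = 1) {h : ℝ} {E : Set (Pt d)}
    (hE : ∀ x ∈ E, ⟪n, x - p⟫_ℝ = h) (hEm : MeasurableSet E) :
    (surf d).restrict E =
      (volume.restrict (slice p n h E)).map (fun w : (ℝ ∙ n)ᗮ => h • n + (w : Pt d) + p) := by
  have hf : Isometry (fun w : (ℝ ∙ n)ᗮ => h • n + (w : Pt d) + p) := by
    intro x y
    simp [edist_dist, Subtype.dist_eq]
  have h1 : (volume : Measure (ℝ ∙ n)ᗮ).map (fun w : (ℝ ∙ n)ᗮ => h • n + (w : Pt d) + p) =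
      (surf d).restrict (Set.range fun w : (ℝ ∙ n)ᗮ => h • n + (w : Pt d) + p) := by
    rw [surf, ← hf.map_euclideanHausdorffMeasure, ← finrank_orthogonal_unit hd hn,
      InnerProductSpace.euclideanHausdorffMeasure_eq_volume]
  have h2 : E ⊆ Set.range fun w : (ℝ ∙ n)ᗮ => h • n + (w : Pt d) + p := by
    intro x hx
    refine ⟨⟨x - p - h • n, ?_⟩, by simp⟩
    rw [Submodule.mem_orthogonal_singleton_iff_inner_right, inner_sub_right, hE x hx,
      inner_smul_right, real_inner_self_eq_norm_sq, hn]
    simp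
  have h3 : slice p n h E = (fun w : (ℝ ∙ n)ᗮ => h • n + (w : Pt d) + p) ⁻¹' E := rfl
  rw [h3, ← Measure.restrict_map hf.continuous.measurable hEm, h1,
    Measure.restrict_restrict hEm, Set.inter_eq_left.2 h2]

lemma isCompact_slice {p n : Pt d} {h : ℝ} {E : Set (Pt d)} (hE : IsCompact E) :
    IsCompact (slice p n h E) := by
  have hf : Isometry (fun w : (ℝ ∙ n)ᗮ => h • n + (w : Pt d) + p) := by
    intro x y
    simp [edist_dist, Subtype.dist_eq]
  exact hf.isClosedEmbedding.isCompact_preimage hE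

/-- The point with parameter `t` on a segment from `p` to the base has height `t h`, so the section
at height `s` is the base scaled by `s / h`. The apex has height zero, which is why `s = 0` is
excluded. -/
lemma mem_cone_iff {p n : Pt d} (hn : ‖n‖ = 1) {h : ℝ} (hh : 0 < h) {E : Set (Pt d)}
    (hE : ∀ x ∈ E, ⟪n, x - p⟫_ℝ = h) {s : ℝ} (hs : s ≠ 0) (w : (ℝ ∙ n)ᗮ) :
    s • n + (w : Pt d) + p ∈ convexJoin ℝ {p} E ↔
      s ∈ Set.Ioc 0 h ∧ w ∈ (s / h) • slice p n h E := by
  have hnw : ⟪n, (w : Pt d)⟫_ℝ = 0 :=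
    Submodule.mem_orthogonal_singleton_iff_inner_right.1 w.2
  simp only [convexJoin_singleton_left, Set.mem_iUnion, exists_prop]
  constructor
  · rintro ⟨y, hy, hx⟩
    rw [segment_eq_image'] at hx
    obtain ⟨t, ht, hx⟩ := hx
    have hx' : t • (y - p) = s • n + (w : Pt d) := by
      have : p + t • (y - p) = s • n + (w : Pt d) + p := hx
      rw [add_comm] at this
      exact add_right_cancel this
    have hst : t * h = s := by
      have := congrArg (fun z => ⟪n, z⟫_ℝ) hx'
      simpa [inner_smul_right, inner_add_right, hE y hy, hnw, hn] using this
    have ht0 : 0 < t := lt_of_le_of_ne ht.1 (by rintro rfl; simp at hst; exact hs hst.symm)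
    refine ⟨⟨by rw [← hst]; positivity, by rw [← hst]; nlinarith [ht.2]⟩, ?_⟩
    have hsh : s / h = t := by rw [← hst]; field_simp
    rw [hsh, Set.mem_smul_set_iff_inv_smul_mem₀ ht0.ne']
    have : h • n + ((t⁻¹ • w : (ℝ ∙ n)ᗮ) : Pt d) + p = y := by
      have h2 : y - p = t⁻¹ • (s • n + (w : Pt d)) := by
        rw [← hx', smul_smul, inv_mul_cancel₀ ht0.ne', one_smul]
      rw [Submodule.coe_smul, ← sub_eq_zero, add_sub_assoc, ← neg_sub y p, h2, smul_add, smul_smul,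
        ← hst]
      have : t⁻¹ * (t * h) = h := by field_simp
      rw [this]; abel
    change h • n + ((t⁻¹ • w : (ℝ ∙ n)ᗮ) : Pt d) + p ∈ E
    rwa [this]
  · rintro ⟨hs', hw⟩
    have ht0 : 0 < s / h := div_pos hs'.1 hh
    rw [Set.mem_smul_set_iff_inv_smul_mem₀ ht0.ne'] at hw
    refine ⟨_, hw, ?_⟩
    rw [segment_eq_image']
    refine ⟨s / h, ⟨ht0.le, (div_le_one hh).2 hs'.2⟩, ?_⟩
    have h3 : s / h * h = s := by field_simp
    simp only [Submodule.coe_smul, add_sub_cancel_right, smul_add, smul_smul,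
      mul_inv_cancel₀ ht0.ne', one_smul, h3]
    abel

lemma isCompact_cone {p : Pt d} {E : Set (Pt d)} (hE : IsCompact E) :
    IsCompact (convexJoin ℝ {p} E) := by
  have : convexJoin ℝ {p} E =
      (fun z : ℝ × Pt d => p + z.1 • (z.2 - p)) '' (Set.Icc (0 : ℝ) 1 ×ˢ E) := by
    ext x
    simp only [convexJoin_singleton_left, Set.mem_iUnion, exists_prop, segment_eq_image',
      Set.mem_image, Set.mem_prod, Prod.exists]
    constructor
    · rintro ⟨y, hy, t, ht, rfl⟩
      exact ⟨t, y, ⟨ht, hy⟩, rfl⟩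
    · rintro ⟨t, y, ⟨ht, hy⟩, rfl⟩
      exact ⟨y, hy, t, ht, rfl⟩
  rw [this]
  exact (isCompact_Icc.prod hE).image (by fun_prop)

/-- Integration over a cone in terms of its base. -/
lemma integral_cone (hd : 1 ≤ d) {p n : Pt d} (hn : ‖n‖ = 1) {h : ℝ} (hh : 0 < h)
    {E : Set (Pt d)} (hE : ∀ x ∈ E, ⟪n, x - p⟫_ℝ = h) (hEc : IsCompact E)
    {F : Pt d → ℝ} (hF : Continuous F) :
    ∫ x in convexJoin ℝ {p} E, F x =
      ∫ s in (0 : ℝ)..h, ∫ w in slice p n h E,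
        (s / h) ^ (d - 1) * F ((s / h) • (h • n + (w : Pt d)) + p) := by
  have hS := isCompact_cone (p := p) hEc
  have hI : Integrable ((convexJoin ℝ {p} E).indicator F) :=
    (integrable_indicator_iff hS.measurableSet).2 (hF.continuousOn.integrableOn_compact hS)
  rw [← integral_indicator hS.measurableSet, ← (measurePreserving_sliceEquiv p hn).integral_comp',
    integral_prod (fun z => (convexJoin ℝ {p} E).indicator F (sliceEquiv p hn z))
      ((measurePreserving_sliceEquiv p hn).integrable_comp_emb
        (sliceEquiv p hn).measurableEmbedding |>.2 hI),
    intervalIntegral.integral_of_le hh.le, ← integral_indicator measurableSet_Ioc]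
  refine integral_congr_ae ?_
  have h0 : ∀ᵐ s : ℝ, s ≠ 0 := by simp [ae_iff]
  filter_upwards [h0] with s hs
  have hK : MeasurableSet (slice p n h E) := (isCompact_slice hEc).measurableSet
  by_cases hsI : s ∈ Set.Ioc 0 h
  · rw [Set.indicator_of_mem hsI]
    have ht0 : 0 < s / h := div_pos hsI.1 hh
    have hfun : (fun w : (ℝ ∙ n)ᗮ => (convexJoin ℝ {p} E).indicator F (sliceEquiv p hn (s, w))) =
        ((s / h) • slice p n h E).indicator (fun w => F (s • n + (w : Pt d) + p)) := by
      funext w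
      rw [sliceEquiv_apply]
      simp only [Set.indicator, mem_cone_iff hn hh hE hs w, hsI, true_and]
    rw [hfun, integral_indicator (hK.const_smul₀ _), integral_const_mul]
    -- Scaling the section back to the base produces the Jacobian `(s / h) ^ (d - 1)`.
    have := Measure.setIntegral_comp_smul_of_pos (volume : Measure (ℝ ∙ n)ᗮ)
      (fun w => F (s • n + (w : Pt d) + p)) (slice p n h E) ht0
    rw [finrank_orthogonal_unit hd hn, smul_eq_mul, eq_inv_mul_iff_mul_eq₀ (by positivity)] at this
    rw [← this]
    congr 1
    refine integral_congr_ae (ae_of_all _ fun w => ?_)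
    have h3 : s / h * h = s := by field_simp
    simp only [Submodule.coe_smul, smul_add, smul_smul, h3]
  · rw [Set.indicator_of_notMem hsI]
    refine integral_eq_zero_of_ae (ae_of_all _ fun w => ?_)
    simp only [sliceEquiv_apply, Pi.zero_apply]
    refine Set.indicator_of_notMem ?_ _
    rw [mem_cone_iff hn hh hE hs w]
    exact fun hx => hsI hx.1

/-- The Green formula on a cone for the field `x - p`, whose normal component vanishes on the lateral
faces. -/
lemma green_cone (hd : 1 ≤ d) {p n : Pt d} (hn : ‖n‖ = 1) {h : ℝ} (hh : 0 < h)
    {E : Set (Pt d)} (hE : ∀ x ∈ E, ⟪n, x - p⟫_ℝ = h) (hEc : IsCompact E)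
    {ψ : Pt d → ℝ} (hψ : ContDiff ℝ 1 ψ) :
    ∫ x in convexJoin ℝ {p} E, (d * ψ x + fderiv ℝ ψ x (x - p)) =
      h * ∫ x in E, ψ x ∂(surf d) := by
  have hcd : Continuous (fderiv ℝ ψ) := hψ.continuous_fderiv (by norm_num)
  have hc := hψ.continuous
  have hF : Continuous fun x => d * ψ x + fderiv ℝ ψ x (x - p) := by fun_prop
  have hK := isCompact_slice (p := p) (n := n) (h := h) hEc
  -- After exchanging the integrals, the inner one runs along the ray from `p` through a fixed base
  -- point.
  rw [integral_cone hd hn hh hE hEc hF, intervalIntegral.integral_of_le hh.le, integral_integral_swap]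
  · rw [surf_restrict_eq_map hd hn hE hEc.measurableSet, integral_map
      (by fun_prop) hc.aestronglyMeasurable, ← integral_const_mul]
    refine integral_congr_ae (ae_of_all _ fun w => ?_)
    beta_reduce
    rw [← intervalIntegral.integral_of_le hh.le]
    set y : Pt d := h • n + (w : Pt d)
    -- This is the antiderivative along the ray: it vanishes at the apex, because `d ≥ 1`, and
    -- equals `h ψ` at the base.
    have hderiv : ∀ s : ℝ, HasDerivAt (fun s : ℝ => h * ((s / h) ^ d * ψ ((s / h) • y + p)))
        ((s / h) ^ (d - 1) * (d * ψ ((s / h) • y + p) +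
          fderiv ℝ ψ ((s / h) • y + p) ((s / h) • y + p - p))) s := by
      intro s
      have h1 : HasDerivAt (fun s : ℝ => s / h) (1 / h) s := (hasDerivAt_id s).div_const h
      have h2 : HasDerivAt (fun s : ℝ => (s / h) • y + p) ((1 / h) • y) s :=
        (h1.smul_const y).add_const p
      have h3 := ((hψ.differentiable (by norm_num) ((s / h) • y + p)).hasFDerivAt).comp_hasDerivAt
        s h2
      have h4 := ((h1.pow d).mul h3).const_mul h
      refine h4.congr_deriv ?_
      simp only [map_smul, smul_eq_mul, add_sub_cancel_right, Function.comp, Pi.pow_apply]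
      have : (s / h) ^ d = (s / h) ^ (d - 1) * (s / h) := by
        rw [← pow_succ]; congr 1; omega
      rw [this]
      field_simp
    rw [intervalIntegral.integral_eq_sub_of_hasDerivAt (fun s _ => hderiv s)]
    · simp [hh.ne', Nat.one_le_iff_ne_zero.1 hd]
    · apply Continuous.intervalIntegrable
      fun_prop
  · rw [Measure.prod_restrict, ← IntegrableOn]
    refine IntegrableOn.mono_set ?_ (Set.prod_mono_left Set.Ioc_subset_Icc_self)
    refine ContinuousOn.integrableOn_compact (isCompact_Icc.prod hK) (Continuous.continuousOn ?_)
    unfold Function.uncurry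
    fun_prop

/-! ### Geometry of simplices -/

lemma isCompact_hull (T : Finset (Pt d)) : IsCompact (hull T) :=
  T.finite_toSet.isCompact_convexHull (𝕜 := ℝ)

lemma convex_hull (T : Finset (Pt d)) : Convex ℝ (hull T) := convex_convexHull ℝ _

lemma subset_hull (T : Finset (Pt d)) : (T : Set (Pt d)) ⊆ hull T := subset_convexHull ℝ _

lemma elt_ae_eq_hull (T : Finset (Pt d)) : elt T =ᵐ[volume] hull T :=
  interior_ae_eq_of_null_frontier ((convex_hull T).addHaar_frontier _)

lemma restrict_elt (T : Finset (Pt d)) :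
    (volume : Measure (Pt d)).restrict (elt T) = volume.restrict (hull T) :=
  Measure.restrict_congr_set (elt_ae_eq_hull T)

lemma interior_hull_nonempty {T : Finset (Pt d)} (hT : T.card = d + 1)
    (hind : AffineIndependent ℝ ((↑) : T → Pt d)) : (elt T).Nonempty := by
  rw [elt, hull, interior_convexHull_nonempty_iff_affineSpan_eq_top]
  have := (hind.affineSpan_eq_top_iff_card_eq_finrank_add_one).2 (by simp [hT])
  simpa using this

lemma exists_insert_of_mem_facesOf {T E : Finset (Pt d)} (hT : T.card = d + 1)
    (hE : E ∈ facesOf T) : ∃ p ∈ T, p ∉ E ∧ T = insert p E := by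
  rw [facesOf, Finset.mem_powersetCard] at hE
  obtain ⟨p, hp, hpE⟩ := Finset.exists_mem_notMem_of_card_lt_card (s := E) (t := T) (by omega)
  refine ⟨p, hp, hpE, (Finset.eq_of_subset_of_card_le ?_ ?_).symm⟩
  · exact Finset.insert_subset hp hE.1
  · rw [Finset.card_insert_of_notMem hpE]; omega

/-- `outwardNormal` is chosen by epsilon and has its properties only once a witness exists. The
witness is the normalised component of `x₀ - p` orthogonal to the affine span of `E`; it is nonzero
because affine independence keeps `p` out of that span. -/
lemma exists_isOutwardNormal (hd : 1 ≤ d) {T E : Finset (Pt d)} (hT : T.card = d + 1)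
    (hind : AffineIndependent ℝ ((↑) : T → Pt d)) (hE : E ∈ facesOf T) :
    ∃ n, IsOutwardNormal T E n := by
  obtain ⟨p, hpT, hpE, rfl⟩ := exists_insert_of_mem_facesOf hT hE
  have hEc : E.card = d := (Finset.mem_powersetCard.1 hE).2
  obtain ⟨x₀, hx₀⟩ : E.Nonempty := Finset.card_pos.1 (by omega)
  have hpaff : p ∉ affineSpan ℝ (E : Set (Pt d)) := by
    have h1 := hind.notMem_affineSpan_sdiff ⟨p, hpT⟩ Set.univ
    intro h2
    refine h1 (affineSpan_mono ℝ ?_ h2)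
    intro x hx
    refine ⟨⟨x, Finset.mem_insert_of_mem hx⟩, ⟨trivial, ?_⟩, rfl⟩
    intro h3
    have : x = p := congrArg Subtype.val h3
    exact hpE (this ▸ hx)
  set V := (affineSpan ℝ (E : Set (Pt d))).direction with hV
  set n₀ : Pt d := Vᗮ.starProjection (x₀ - p) with hn₀
  have hx₀' := mem_affineSpan ℝ (Finset.mem_coe.2 hx₀)
  have hne : n₀ ≠ 0 := by
    intro h0
    have h1 : x₀ - p ∈ V := by
      rw [← Submodule.orthogonal_orthogonal V]
      exact (Submodule.starProjection_apply_eq_zero_iff _).1 h0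
    have h2 : p - x₀ ∈ V := by rw [← neg_sub]; exact V.neg_mem h1
    have h3 := AffineSubspace.vadd_mem_of_mem_direction h2 hx₀'
    exact hpaff (by simpa using h3)
  have hpos : 0 < ‖n₀‖ := norm_pos_iff.2 hne
  have horth : ∀ x ∈ E, ∀ y ∈ E, ⟪n₀, x - y⟫_ℝ = 0 := by
    intro x hx y hy
    have h1 : x - y ∈ V := AffineSubspace.vsub_mem_direction
      (mem_affineSpan ℝ (Finset.mem_coe.2 hx)) (mem_affineSpan ℝ (Finset.mem_coe.2 hy))
    exact Submodule.inner_left_of_mem_orthogonal h1 (Submodule.starProjection_apply_mem _ _)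
  have hin : ⟪n₀, x₀ - p⟫_ℝ = ‖n₀‖ ^ 2 := by
    have h1 : ⟪n₀, (x₀ - p) - n₀⟫_ℝ = 0 :=
      Submodule.inner_right_of_mem_orthogonal (Submodule.starProjection_apply_mem _ _)
        (Submodule.sub_starProjection_mem_orthogonal _)
    rw [inner_sub_right, real_inner_self_eq_norm_sq] at h1
    linarith
  refine ⟨‖n₀‖⁻¹ • n₀, ?_, ?_, ?_⟩
  · rw [norm_smul, norm_inv, norm_norm, inv_mul_cancel₀ hpos.ne']
  · intro x hx y hy
    rw [real_inner_smul_left, horth x hx y hy, mul_zero]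
  · intro p' hp' hp'E x hx
    obtain rfl : p' = p := (Finset.mem_insert.1 hp').resolve_right hp'E
    have h1 : ⟪n₀, p' - x⟫_ℝ = -‖n₀‖ ^ 2 := by
      have : p' - x = (x₀ - x) - (x₀ - p') := by abel
      rw [this, inner_sub_right, horth x₀ hx₀ x hx, hin]
      ring
    rw [real_inner_smul_left, h1]
    have : ‖n₀‖⁻¹ * -‖n₀‖ ^ 2 = -‖n₀‖ := by field_simp
    rw [this]; linarith

lemma isOutwardNormal_outwardNormal (hd : 1 ≤ d) {T E : Finset (Pt d)} (hT : T.card = d + 1)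
    (hind : AffineIndependent ℝ ((↑) : T → Pt d)) (hE : E ∈ facesOf T) :
    IsOutwardNormal T E (outwardNormal T E) :=
  Classical.epsilon_spec (exists_isOutwardNormal hd hT hind hE)

/-- The vertex `p` of `T` lies opposite to the face `E`, at the distance `h` from it. -/
structure IsOpposite (T E : Finset (Pt d)) (p : Pt d) (h : ℝ) : Prop where
  mem : p ∈ T
  hull_eq : hull T = convexJoin ℝ {p} (hull E)
  unit : ‖outwardNormal T E‖ = 1
  pos : 0 < h
  height : ∀ x ∈ hull E, ⟪outwardNormal T E, x - p⟫_ℝ = h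
  lateral : ∀ E' ∈ facesOf T, E' ≠ E → ∀ x ∈ hull E', ⟪outwardNormal T E', x - p⟫_ℝ = 0

lemma inner_sub_eq_of_mem_hull {E : Finset (Pt d)} {n p : Pt d} {h : ℝ}
    (hE : ∀ x ∈ E, ⟪n, x - p⟫_ℝ = h) : ∀ x ∈ hull E, ⟪n, x - p⟫_ℝ = h := by
  have h1 : hull E ⊆ {x | ⟪n, x⟫_ℝ = h + ⟪n, p⟫_ℝ} := by
    refine convexHull_min ?_ (convex_hyperplane (innerSL ℝ n).isLinear _)
    intro x hx
    have := hE x hx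
    rw [inner_sub_right] at this
    simp only [Set.mem_ofPred_eq]
    linarith
  intro x hx
  have : ⟪n, x⟫_ℝ = h + ⟪n, p⟫_ℝ := h1 hx
  rw [inner_sub_right, this]; ring

lemma exists_isOpposite (hd : 1 ≤ d) {T E : Finset (Pt d)} (hT : T.card = d + 1)
    (hind : AffineIndependent ℝ ((↑) : T → Pt d)) (hE : E ∈ facesOf T) :
    ∃ p h, IsOpposite T E p h := by
  obtain ⟨p, hpT, hpE, hTE⟩ := exists_insert_of_mem_facesOf hT hE
  have hn := isOutwardNormal_outwardNormal hd hT hind hE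
  have hEc : E.card = d := (Finset.mem_powersetCard.1 hE).2
  obtain ⟨x₀, hx₀⟩ : E.Nonempty := Finset.card_pos.1 (by omega)
  refine ⟨p, ⟪outwardNormal T E, x₀ - p⟫_ℝ, hpT, ?_, hn.unit, ?_, ?_, ?_⟩
  · rw [hull, hull, hTE, Finset.coe_insert, convexHull_insert ⟨x₀, hx₀⟩]
  · have := hn.out p hpT hpE x₀ hx₀
    rw [← neg_sub, inner_neg_right] at this
    linarith
  · refine inner_sub_eq_of_mem_hull fun x hx => ?_
    have h1 := hn.orth x hx x₀ hx₀
    have : x - p = (x - x₀) + (x₀ - p) := by abel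
    rw [this, inner_add_right, h1, zero_add]
  · intro E' hE' hne
    have hn' := isOutwardNormal_outwardNormal hd hT hind hE'
    have hE'' := Finset.mem_powersetCard.1 hE'
    -- A face that omits `p` is contained in `E` and has as many vertices, hence is `E`.
    have hpE' : p ∈ E' := by
      by_contra hp'
      refine hne (Finset.eq_of_subset_of_card_le ?_ (by omega))
      intro x hx
      have hxT := hE''.1 hx
      rw [hTE] at hxT
      exact (Finset.mem_insert.1 hxT).resolve_left (by rintro rfl; exact hp' hx)
    exact inner_sub_eq_of_mem_hull fun x hx => hn'.orth x hx p hpE'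

namespace IsOpposite

variable {T E : Finset (Pt d)} {p : Pt d} {h : ℝ}

lemma green (ho : IsOpposite T E p h) (hd : 1 ≤ d) {ψ : Pt d → ℝ} (hψ : ContDiff ℝ 1 ψ) :
    ∫ x in hull T, (d * ψ x + fderiv ℝ ψ x (x - p)) = h * ∫ x in hull E, ψ x ∂(surf d) := by
  rw [ho.hull_eq]
  exact green_cone hd ho.unit ho.pos ho.height (isCompact_hull E) hψ

lemma surf_lt_top (ho : IsOpposite T E p h) (hd : 1 ≤ d) : surf d (hull E) < ∞ := by
  rw [← Measure.restrict_apply_self, surf_restrict_eq_map hd ho.unit ho.height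
    (isCompact_hull E).measurableSet]
  rw [Measure.map_apply (by fun_prop) (isCompact_hull E).measurableSet]
  refine (measure_mono (Set.subset_univ _)).trans_lt ?_
  rw [Measure.restrict_apply_univ]
  exact (isCompact_slice (isCompact_hull E)).measure_lt_top

lemma mul_surf (ho : IsOpposite T E p h) (hd : 1 ≤ d) :
    d * volume.real (hull T) = h * (surf d).real (hull E) := by
  have := ho.green hd (ψ := fun _ => 1) contDiff_const
  simpa [mul_comm] using this

lemma inner_mem_Icc (ho : IsOpposite T E p h) {x : Pt d} (hx : x ∈ hull T) :
    ⟪outwardNormal T E, x - p⟫_ℝ ∈ Set.Icc 0 h := by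
  rw [ho.hull_eq] at hx
  simp only [convexJoin_singleton_left, Set.mem_iUnion, exists_prop, segment_eq_image'] at hx
  obtain ⟨y, hy, t, ht, rfl⟩ := hx
  simp only [add_sub_cancel_left, inner_smul_right, ho.height y hy]
  exact ⟨mul_nonneg ht.1 ho.pos.le, by nlinarith [ho.pos, ht.2]⟩

/-- The simplex lies in the slab of width `h` between the plane of `E` and its parallel through `p`.
The two points of an inscribed ball that are extreme in the normal direction are `2 r` apart. -/
lemma two_mul_inradius_le (ho : IsOpposite T E p h) : 2 * inradius T ≤ h := by
  have : inradius T ≤ h / 2 := by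
    refine Real.sSup_le ?_ (by linarith [ho.pos])
    rintro r ⟨hr, x, hx⟩
    have h1 := ho.inner_mem_Icc (hx (show x + r • outwardNormal T E ∈ _ by
      simp [norm_smul, ho.unit, abs_of_nonneg hr]))
    have h2 := ho.inner_mem_Icc (hx (show x - r • outwardNormal T E ∈ _ by
      simp [norm_smul, ho.unit, abs_of_nonneg hr]))
    rw [show x + r • outwardNormal T E - p = (x - p) + r • outwardNormal T E by abel,
      inner_add_right, inner_smul_right, real_inner_self_eq_norm_sq, ho.unit] at h1
    rw [show x - r • outwardNormal T E - p = (x - p) - r • outwardNormal T E by abel,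
      inner_sub_right, inner_smul_right, real_inner_self_eq_norm_sq, ho.unit] at h2
    linarith [h1.2, h2.1]
  linarith

end IsOpposite

lemma inradius_pos (hd : 1 ≤ d) {T : Finset (Pt d)} (hT : T.card = d + 1)
    (hind : AffineIndependent ℝ ((↑) : T → Pt d)) : 0 < inradius T := by
  obtain ⟨E, hE⟩ : (facesOf T).Nonempty := Finset.powersetCard_nonempty.2 (by omega)
  obtain ⟨p, h, ho⟩ := exists_isOpposite hd hT hind hE
  obtain ⟨x, hx⟩ := interior_hull_nonempty hT hind
  obtain ⟨r, hr, hball⟩ := Metric.nhds_basis_closedBall.mem_iff.1 (mem_interior_iff_mem_nhds.1 hx)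
  -- A real supremum of an unbounded set would be zero, so the admissible radii must be bounded; the
  -- diameter bounds them.
  refine lt_of_lt_of_le hr (le_csSup ?_ ⟨hr.le, x, hball⟩)
  refine ⟨Metric.diam (hull T), ?_⟩
  rintro s ⟨hs, y, hy⟩
  have h1 : y + s • outwardNormal T E ∈ hull T := hy (by
      simp [norm_smul, ho.unit, abs_of_nonneg hs])
  have h2 := Metric.dist_le_diam_of_mem (isCompact_hull T).isBounded h1
    (hy (Metric.mem_closedBall_self hs))
  simpa [norm_smul, ho.unit, abs_of_nonneg hs] using h2

/-- `diamT` is the diameter of the interior, but a convex set with nonempty interior has the same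
closure as that interior, so vertices and faces are covered too. -/
lemma dist_le_diamT {T : Finset (Pt d)} (hT : T.card = d + 1)
    (hind : AffineIndependent ℝ ((↑) : T → Pt d)) {x y : Pt d} (hx : x ∈ hull T)
    (hy : y ∈ hull T) : dist x y ≤ diamT T := by
  have h1 : closure (elt T) = hull T := by
    rw [elt, (convex_hull T).closure_interior_eq_closure_of_nonempty_interior
      (interior_hull_nonempty hT hind), (isCompact_hull T).isClosed.closure_eq]
  rw [diamT, ← Metric.diam_closure, h1]
  exact Metric.dist_le_diam_of_mem (isCompact_hull T).isBounded hx hy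

lemma diamT_pos (hd : 1 ≤ d) {T : Finset (Pt d)} (hT : T.card = d + 1)
    (hind : AffineIndependent ℝ ((↑) : T → Pt d)) : 0 < diamT T := by
  obtain ⟨x, hx, y, hy, hxy⟩ := Finset.one_lt_card.1 (show 1 < T.card by omega)
  exact (dist_pos.2 hxy).trans_le (dist_le_diamT hT hind (subset_hull T hx) (subset_hull T hy))

lemma volume_hull_pos {T : Finset (Pt d)} (hT : T.card = d + 1)
    (hind : AffineIndependent ℝ ((↑) : T → Pt d)) : 0 < volume.real (hull T) := by
  refine ENNReal.toReal_pos ?_ (isCompact_hull T).measure_lt_top.ne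
  exact ne_of_gt ((isOpen_interior.measure_pos volume (interior_hull_nonempty hT hind)).trans_le
    (measure_mono interior_subset))

/-- A shape regular simplex is not thin: the heights are comparable to the diameter. -/
lemma IsOpposite.diamT_le (hd : 1 ≤ d) {T E : Finset (Pt d)} {p : Pt d} {h : ℝ}
    (ho : IsOpposite T E p h) (hT : T.card = d + 1)
    (hind : AffineIndependent ℝ ((↑) : T → Pt d)) {γ₀ : ℝ} (hγ : diamT T / inradius T ≤ γ₀) :
    diamT T ≤ max γ₀ 1 * h := by
  have h1 := inradius_pos hd hT hind
  rw [div_le_iff₀ h1] at hγ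
  have h2 := ho.two_mul_inradius_le
  calc diamT T ≤ γ₀ * inradius T := hγ
    _ ≤ max γ₀ 1 * inradius T := by gcongr; exact le_max_left _ _
    _ ≤ max γ₀ 1 * h := by
      gcongr
      linarith

/-! ### Elements lie in the domain -/

/-- A Lipschitz domain lies on one side of its boundary. -/
lemma IsLipschitzDomain.interior_closure_subset {D : Set (Pt d)} (hD : IsLipschitzDomain D) :
    interior (closure D) ⊆ D := by
  intro x hx
  by_contra hxD
  have hfr : x ∈ frontier D := ⟨interior_subset hx, fun h => hxD (interior_subset h)⟩
  obtain ⟨r, hr, e, he, K, φ, hφ, hinv, hgraph⟩ := hD.graph x hfr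
  obtain ⟨ε, hε, hball⟩ := Metric.isOpen_iff.1 isOpen_interior x hx
  have hle : ⟪e, x⟫_ℝ ≤ φ x := by
    by_contra hlt
    exact hxD ((hgraph x (Metric.mem_ball_self hr)).2 (not_le.1 hlt))
  -- Moving from `x` by `t` against `e` leaves `φ` unchanged and lowers the height, so `y` is
  -- strictly below the graph. It is still in the closure of `D`, yet has a neighbourhood free of
  -- points of `D`.
  set t := min r ε / 2 with ht
  have ht0 : 0 < t := by positivity
  have htr : t < r := by have := min_le_left r ε; linarith [lt_min hr hε]
  have htε : t < ε := by have := min_le_right r ε; linarith [lt_min hr hε]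
  set y := x + (-t) • e with hy
  have hdist : dist y x = t := by simp [hy, norm_smul, he, abs_of_pos ht0]
  have hyc : y ∈ closure D := interior_subset (hball (by rw [Metric.mem_ball, hdist]; exact htε))
  have hlt : ⟪e, y⟫_ℝ < φ y := by
    rw [hy, hinv, inner_add_right, inner_smul_right, real_inner_self_eq_norm_sq, he]
    linarith
  have hopen : IsOpen ({z | ⟪e, z⟫_ℝ < φ z} ∩ Metric.ball x r) :=
    (isOpen_lt (by fun_prop) hφ.continuous).inter Metric.isOpen_ball
  obtain ⟨z, ⟨hz1, hz2⟩, hz3⟩ := mem_closure_iff.1 hyc _ hopen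
    ⟨hlt, by rw [Metric.mem_ball, hdist]; exact htr⟩
  exact absurd ((hgraph z hz2).1 hz3) (not_lt.2 (le_of_lt hz1))

variable {D : Set (Pt d)}

lemma Triangulation.hull_subset (𝒯 : Triangulation D) {T : Finset (Pt d)} (hT : T ∈ 𝒯.cells) :
    hull T ⊆ closure D := by
  rw [← 𝒯.cover]
  exact Set.subset_biUnion_of_mem (u := fun T : Finset (Pt d) => convexHull ℝ (T : Set (Pt d)))
    (Finset.mem_coe.2 hT)

/-- The triangulation covers only the closure of `D`, so an open element could contain points of a
slit. The graph condition on the boundary serves to exclude this. -/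
lemma Triangulation.elt_subset (𝒯 : Triangulation D) (hD : IsLipschitzDomain D)
    {T : Finset (Pt d)} (hT : T ∈ 𝒯.cells) : elt T ⊆ D :=
  (interior_mono (𝒯.hull_subset hT)).trans hD.interior_closure_subset

/-! ### Mollification -/

lemma eLpNorm_two_sq {α F : Type*} [MeasurableSpace α] [NormedAddCommGroup F] (μ : Measure α)
    (f : α → F) : eLpNorm f 2 μ ^ 2 = ∫⁻ x, ‖f x‖ₑ ^ 2 ∂μ := by
  have := eLpNorm_nnreal_pow_eq_lintegral (p := 2) (f := f) (μ := μ) (by norm_num)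
  simpa using this

section Mollify

variable {F : Type*} [NormedAddCommGroup F] [NormedSpace ℝ F]

/-- The mollification of `f` by the bump function `φ`. -/
noncomputable def mollify (φ : ContDiffBump (0 : Pt d)) (f : Pt d → F) : Pt d → F :=
  φ.normed volume ⋆[ContinuousLinearMap.lsmul ℝ ℝ, volume] f

lemma mollify_apply (φ : ContDiffBump (0 : Pt d)) (f : Pt d → F) (x : Pt d) :
    mollify φ f x = ∫ t, φ.normed volume t • f (x - t) := rfl

/-- Mollification averages translates against the probability measure `ν` with density `φ`.
Pointwise, the `L¹` norm over `ν` is at most the `L²` norm; Tonelli and translation invariance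
finish the bound. -/
lemma eLpNorm_mollify_le (φ : ContDiffBump (0 : Pt d)) {f : Pt d → F}
    (hf : AEStronglyMeasurable f volume) :
    eLpNorm (mollify φ f) 2 volume ≤ eLpNorm f 2 volume := by
  set k : Pt d → ℝ≥0∞ := fun t => ENNReal.ofReal (φ.normed volume t) with hk
  have hkm : Measurable k := (φ.continuous_normed.measurable).ennreal_ofReal
  set ν := (volume : Measure (Pt d)).withDensity k with hν
  have hprob : IsProbabilityMeasure ν := by
    constructor
    rw [hν, withDensity_apply _ MeasurableSet.univ, Measure.restrict_univ, hk,
      ← ofReal_integral_eq_lintegral_ofReal φ.integrable_normed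
        (ae_of_all _ φ.nonneg_normed), φ.integral_normed, ENNReal.ofReal_one]
  have hprod : AEStronglyMeasurable (fun z : Pt d × Pt d => f (z.1 - z.2)) (volume.prod ν) :=
    hf.comp_quasiMeasurePreserving (quasiMeasurePreserving_sub_of_right_invariant _ _)
  have hshift : ∀ x, AEStronglyMeasurable (fun t => f (x - t)) ν := fun x =>
    (hf.comp_quasiMeasurePreserving
      (Measure.measurePreserving_sub_left volume x).quasiMeasurePreserving).mono_ac
      (withDensity_absolutelyContinuous _ _)
  have hpt : ∀ x, ‖mollify φ f x‖ₑ ^ 2 ≤ ∫⁻ t, ‖f (x - t)‖ₑ ^ 2 ∂ν := by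
    intro x
    have h1 : ‖mollify φ f x‖ₑ ≤ eLpNorm (fun t => f (x - t)) 1 ν := by
      rw [mollify_apply, eLpNorm_one_eq_lintegral_enorm, hν,
        lintegral_withDensity_eq_lintegral_mul_non_measurable _ hkm
          (ae_of_all _ fun t => ENNReal.ofReal_lt_top)]
      refine (enorm_integral_le_lintegral_enorm _).trans (le_of_eq ?_)
      refine lintegral_congr fun t => ?_
      rw [enorm_smul, Pi.mul_apply, hk, Real.enorm_eq_ofReal (φ.nonneg_normed t)]
    have h2 := h1.trans (eLpNorm_le_eLpNorm_of_exponent_le (by norm_num : (1 : ℝ≥0∞) ≤ 2)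
      (hshift x))
    calc ‖mollify φ f x‖ₑ ^ 2 ≤ eLpNorm (fun t => f (x - t)) 2 ν ^ 2 := by gcongr
      _ = _ := eLpNorm_two_sq _ _
  have hsq : eLpNorm (mollify φ f) 2 volume ^ 2 ≤ eLpNorm f 2 volume ^ 2 := by
    rw [eLpNorm_two_sq, eLpNorm_two_sq]
    calc ∫⁻ x, ‖mollify φ f x‖ₑ ^ 2 ≤ ∫⁻ x, ∫⁻ t, ‖f (x - t)‖ₑ ^ 2 ∂ν ∂volume := lintegral_mono hpt
      _ = ∫⁻ t, ∫⁻ x, ‖f (x - t)‖ₑ ^ 2 ∂volume ∂ν :=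
        lintegral_lintegral_swap (f := fun x t => ‖f (x - t)‖ₑ ^ 2) (hprod.enorm.pow_const 2)
      _ = ∫⁻ t, ∫⁻ x, ‖f x‖ₑ ^ 2 ∂volume ∂ν := by
        refine lintegral_congr fun t => ?_
        exact lintegral_sub_right_eq_self (fun x => ‖f x‖ₑ ^ 2) t
      _ = ∫⁻ x, ‖f x‖ₑ ^ 2 := by simp
  exact (ENNReal.pow_le_pow_left_iff (by norm_num)).1 hsq

lemma contDiff_mollify (φ : ContDiffBump (0 : Pt d)) {f : Pt d → F}
    (hf : LocallyIntegrable f volume) : ContDiff ℝ (⊤ : ℕ∞) (mollify φ f) :=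
  φ.hasCompactSupport_normed.contDiff_convolution_left _ φ.contDiff_normed hf

lemma mollify_sub (φ : ContDiffBump (0 : Pt d)) {f g : Pt d → F}
    (hf : LocallyIntegrable f volume) (hg : LocallyIntegrable g volume) :
    mollify φ (f - g) = mollify φ f - mollify φ g := by
  funext x
  have h (f : Pt d → F) (hf : LocallyIntegrable f volume) :
      Integrable (fun t => φ.normed volume t • f (x - t)) :=
    φ.hasCompactSupport_normed.convolutionExists_left (ContinuousLinearMap.lsmul ℝ ℝ)
      φ.continuous_normed hf x
  rw [Pi.sub_apply, mollify_apply, mollify_apply, mollify_apply, ← integral_sub (h f hf) (h g hg)]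
  simp [smul_sub]

/-- Density argument: replace `f` by a continuous compactly supported `g`. Two of the three error
terms are controlled by `f - g`, since mollification is a contraction; the third is uniformly small
by uniform continuity of `g`, hence small in `L²` on the bounded set `D`. -/
lemma tendsto_mollify [CompleteSpace F] {φ : ℕ → ContDiffBump (0 : Pt d)}
    (hφ : Tendsto (fun i => (φ i).rOut) atTop (𝓝 0)) {D : Set (Pt d)}
    (hD : Bornology.IsBounded D) {f : Pt d → F} (hf : MemLp f 2 volume) :
    Tendsto (fun i => eLpNorm (fun x => mollify (φ i) f x - f x) 2 (volume.restrict D))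
      atTop (𝓝 0) := by
  rw [ENNReal.tendsto_nhds_zero]
  intro ε hε
  obtain ⟨δ, hδ0, hδ⟩ : ∃ δ : ℝ≥0∞, 0 < δ ∧ 3 * δ ≤ ε := by
    refine ⟨ε / 3, ENNReal.div_pos hε.ne' (by norm_num), ?_⟩
    exact ENNReal.mul_div_le
  obtain ⟨g, hgc, hfg, hg, hgL⟩ :=
    hf.exists_hasCompactSupport_eLpNorm_sub_le (by norm_num) hδ0.ne'
  have hvol : volume D ≠ ∞ := hD.measure_lt_top.ne
  obtain ⟨η, hη0, hη⟩ : ∃ η : ℝ, 0 < η ∧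
      (volume D) ^ ((2 : ℝ≥0∞).toReal⁻¹) * ENNReal.ofReal η ≤ δ := by
    have h1 : Tendsto (fun η : ℝ => (volume D) ^ ((2 : ℝ≥0∞).toReal⁻¹) * ENNReal.ofReal η)
        (𝓝[>] 0) (𝓝 0) := by
      have h2 := ENNReal.Tendsto.const_mul (a := (volume D) ^ ((2 : ℝ≥0∞).toReal⁻¹))
        (ENNReal.tendsto_ofReal (tendsto_nhdsWithin_of_tendsto_nhds
          (tendsto_id (x := 𝓝 (0 : ℝ))) (s := Set.Ioi 0)))
        (Or.inr (ENNReal.rpow_ne_top_of_nonneg (by positivity) hvol))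
      simpa using h2
    obtain ⟨η, h3, h4⟩ := ((ENNReal.tendsto_nhds_zero.1 h1 δ hδ0).and
      self_mem_nhdsWithin).exists
    exact ⟨η, h4, h3⟩
  obtain ⟨r, hr0, hr⟩ := Metric.uniformContinuous_iff.1
    (hgc.uniformContinuous_of_continuous hg) η hη0
  filter_upwards [hφ.eventually (gt_mem_nhds hr0)] with i hi
  have hfl := hf.locallyIntegrable (by norm_num)
  have hgl := hgL.locallyIntegrable (by norm_num)
  have hdecomp : (fun x => mollify (φ i) f x - f x) =
      mollify (φ i) (f - g) + ((fun x => mollify (φ i) g x - g x) + (g - f)) := by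
    rw [mollify_sub _ hfl hgl]
    funext x
    simp only [Pi.add_apply, Pi.sub_apply]
    abel
  have hm1 : AEStronglyMeasurable (mollify (φ i) (f - g)) (volume.restrict D) :=
    (contDiff_mollify (φ i) (hfl.sub hgl)).continuous.aestronglyMeasurable
  have hm2 : AEStronglyMeasurable (fun x => mollify (φ i) g x - g x) (volume.restrict D) :=
    ((contDiff_mollify (φ i) hgl).continuous.sub hg).aestronglyMeasurable
  have hm3 : AEStronglyMeasurable (g - f) (volume.restrict D) :=
    (hg.aestronglyMeasurable.sub hf.1).restrict
  rw [hdecomp]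
  refine (eLpNorm_add_le hm1 (hm2.add hm3) (by norm_num)).trans ?_
  refine (add_le_add le_rfl (eLpNorm_add_le hm2 hm3 (by norm_num))).trans ?_
  refine le_trans (le_of_le_of_eq (b := δ + (δ + δ)) ?_ (by ring)) hδ
  refine add_le_add ?_ (add_le_add ?_ ?_)
  · exact (eLpNorm_mono_measure _ Measure.restrict_le_self).trans
      ((eLpNorm_mollify_le (φ i) (hf.1.sub hgL.1)).trans hfg)
  · refine le_trans (eLpNorm_le_of_ae_bound (C := η) (ae_of_all _ fun x => ?_)) ?_
    · rw [← dist_eq_norm]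
      refine (φ i).dist_normed_convolution_le hg.aestronglyMeasurable fun y hy => (hr ?_).le
      exact lt_trans (Metric.mem_ball.1 hy) hi
    · rwa [Measure.restrict_apply_univ]
  · refine (eLpNorm_mono_measure _ Measure.restrict_le_self).trans ?_
    rwa [eLpNorm_sub_comm]

end Mollify

/-- Mollification commutes with weak differentiation. -/
lemma gradient_mollify (φ : ContDiffBump (0 : Pt d)) {w : Pt d → ℝ} {G : Pt d → Pt d}
    (hw : LocallyIntegrable w volume) (hG : LocallyIntegrable G volume)
    (hweak : ∀ χ, IsTestFunction Set.univ χ → ∀ e : Pt d,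
      ∫ x, w x * fderiv ℝ χ x e = -∫ x, ⟪G x, e⟫_ℝ * χ x) (x : Pt d) :
    gradient (mollify φ w) x = mollify φ G x := by
  have hk := φ.contDiff_normed (n := (⊤ : ℕ∞)) (μ := (volume : Measure (Pt d)))
  have hkd : Differentiable ℝ (φ.normed (volume : Measure (Pt d))) :=
    hk.differentiable (by simp)
  refine ext_inner_right ℝ fun e => ?_
  rw [inner_gradient_left]
  have h1 := φ.hasCompactSupport_normed.hasFDerivAt_convolution_left
    (ContinuousLinearMap.lsmul ℝ ℝ) (hk.of_le (by simp)) hw x (μ := (volume : Measure (Pt d)))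
  have h2 : fderiv ℝ (mollify φ w) x e =
      ∫ t, fderiv ℝ (φ.normed volume) t e * w (x - t) := by
    rw [mollify, h1.fderiv, convolution_def, ContinuousLinearMap.integral_apply]
    · simp [ContinuousLinearMap.precompL_apply]
    · exact (φ.hasCompactSupport_normed.fderiv ℝ).convolutionExists_left _
        (hk.continuous_fderiv (by simp)) hw x
  have h3 : Integrable (fun t => φ.normed volume t • G (x - t)) :=
    φ.hasCompactSupport_normed.convolutionExists_left (ContinuousLinearMap.lsmul ℝ ℝ)
      φ.continuous_normed hG x
  have h4 : ⟪mollify φ G x, e⟫_ℝ = ∫ t, φ.normed volume t * ⟪G (x - t), e⟫_ℝ := by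
    rw [mollify_apply, real_inner_comm, ← integral_inner h3]
    refine integral_congr_ae (ae_of_all _ fun t => ?_)
    simp only [inner_smul_right, real_inner_comm]
  -- The weak identity is tested with the reflected kernel `y ↦ φ (x - y)`, which turns both sides
  -- into convolutions; the sign from the reflection cancels the sign of the weak derivative.
  have htest : IsTestFunction Set.univ (fun y => φ.normed volume (x - y)) := by
    refine ⟨hk.comp (contDiff_const.sub contDiff_id), ?_, Set.subset_univ _⟩
    exact φ.hasCompactSupport_normed.comp_homeomorph (Homeomorph.subLeft x)
  have hder : ∀ y, fderiv ℝ (fun y => φ.normed volume (x - y)) y e =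
      -fderiv ℝ (φ.normed volume) (x - y) e := by
    intro y
    have := ((hkd (x - y)).hasFDerivAt.comp y ((hasFDerivAt_id y).const_sub x)).fderiv
    change fderiv ℝ (φ.normed volume ∘ fun y => x - y) y e = _
    rw [this]
    simp
  have h5 := hweak _ htest e
  rw [h2, h4, ← integral_sub_left_eq_self _ volume x,
    ← integral_sub_left_eq_self (fun t => φ.normed volume t * ⟪G (x - t), e⟫_ℝ) volume x]
  simp only [sub_sub_cancel]
  simp only [hder, mul_neg, integral_neg, neg_inj] at h5
  calc _ = _ := by simp only [mul_comm]
    _ = _ := h5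
    _ = _ := by simp only [mul_comm]

/-- Functions with weak derivatives on the whole space are approximated by smooth functions. -/
lemma exists_smooth_approx {D : Set (Pt d)} (hD : Bornology.IsBounded D) {w : Pt d → ℝ}
    {G : Pt d → Pt d} (hw : MemLp w 2 volume) (hG : MemLp G 2 volume)
    (hweak : ∀ χ, IsTestFunction Set.univ χ → ∀ e : Pt d,
      ∫ x, w x * fderiv ℝ χ x e = -∫ x, ⟪G x, e⟫_ℝ * χ x) :
    ∃ ψ : ℕ → Pt d → ℝ, (∀ n, ContDiff ℝ (⊤ : ℕ∞) (ψ n)) ∧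
      Tendsto (fun n => eLpNorm (fun x => ψ n x - w x) 2 (volume.restrict D)) atTop (𝓝 0) ∧
      Tendsto (fun n => eLpNorm (fun x => gradient (ψ n) x - G x) 2 (volume.restrict D))
        atTop (𝓝 0) := by
  set φ : ℕ → ContDiffBump (0 : Pt d) := fun n =>
    ⟨1 / (2 * ((n : ℝ) + 1)), 1 / ((n : ℝ) + 1), by positivity, by
      apply one_div_lt_one_div_of_lt <;> linarith [n.cast_nonneg (α := ℝ)]⟩
  have hφ : Tendsto (fun i => (φ i).rOut) atTop (𝓝 0) := tendsto_one_div_add_atTop_nhds_zero_nat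
  refine ⟨fun n => mollify (φ n) w, fun n => contDiff_mollify _ (hw.locallyIntegrable (by norm_num)),
    tendsto_mollify hφ hD hw, ?_⟩
  simp only [gradient_mollify _ (hw.locallyIntegrable (by norm_num))
    (hG.locallyIntegrable (by norm_num)) hweak]
  exact tendsto_mollify hφ hD hG

/-! ### Square integrable functions -/

section L2

variable {α F : Type*} [MeasurableSpace α] {μ : Measure α} [NormedAddCommGroup F]

lemma integrable_mul_of_memLp {f g : α → ℝ} (hf : MemLp f 2 μ) (hg : MemLp g 2 μ) :
    Integrable (fun x => f x * g x) μ := hf.integrable_mul hg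

lemma eLpNorm_two_sq_eq_ofReal {f : α → F} (hf : MemLp f 2 μ) :
    eLpNorm f 2 μ ^ 2 = ENNReal.ofReal (∫ x, ‖f x‖ ^ 2 ∂μ) := by
  rw [eLpNorm_two_sq, ofReal_integral_eq_lintegral_ofReal
    ((memLp_two_iff_integrable_sq_norm hf.1).1 hf) (ae_of_all _ fun x => by positivity)]
  refine lintegral_congr fun x => ?_
  rw [ENNReal.ofReal_pow (norm_nonneg _), ofReal_norm]

lemma exists_limit_of_eLpNorm_le [CompleteSpace F] {f : ℕ → α → F} (hf : ∀ n, MemLp (f n) 2 μ)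
    {c : ℕ → ℝ≥0∞} (hc : Tendsto c atTop (𝓝 0))
    (hcau : ∀ n m, eLpNorm (f n - f m) 2 μ ≤ c n + c m) :
    ∃ γ, MemLp γ 2 μ ∧ Tendsto (fun n => eLpNorm (fun x => f n x - γ x) 2 μ) atTop (𝓝 0) := by
  have h1 : CauchySeq fun n => (hf n).toLp (f n) := by
    rw [EMetric.cauchySeq_iff]
    intro ε hε
    obtain ⟨N, hN⟩ := eventually_atTop.1
      (hc.eventually (gt_mem_nhds (ENNReal.half_pos hε.ne')))
    refine ⟨N, fun m hm n hn => ?_⟩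
    rw [Lp.edist_toLp_toLp]
    calc _ ≤ c m + c n := hcau m n
      _ < ε / 2 + ε / 2 := ENNReal.add_lt_add (hN m hm) (hN n hn)
      _ = ε := ENNReal.add_halves ε
  obtain ⟨γ, hγ⟩ := cauchySeq_tendsto_of_complete h1
  refine ⟨γ, Lp.memLp γ, ?_⟩
  have := (Lp.tendsto_Lp_iff_tendsto_eLpNorm'' f hf γ (Lp.memLp γ)).1 (by simpa using hγ)
  exact this

variable [InnerProductSpace ℝ F]

lemma integral_inner_eq_inner_toLp {f g : α → F} (hf : MemLp f 2 μ) (hg : MemLp g 2 μ) :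
    ∫ x, ⟪f x, g x⟫_ℝ ∂μ = ⟪hf.toLp f, hg.toLp g⟫_ℝ := by
  rw [L2.inner_def]
  refine integral_congr_ae ?_
  filter_upwards [hf.coeFn_toLp, hg.coeFn_toLp] with x h1 h2
  rw [h1, h2]

lemma integrable_inner_of_memLp {f g : α → F} (hf : MemLp f 2 μ) (hg : MemLp g 2 μ) :
    Integrable (fun x => ⟪f x, g x⟫_ℝ) μ := by
  refine (L2.integrable_inner (𝕜 := ℝ) (hf.toLp f) (hg.toLp g)).congr ?_
  filter_upwards [hf.coeFn_toLp, hg.coeFn_toLp] with x h1 h2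
  rw [h1, h2]

lemma abs_integral_inner_le {f g : α → F} (hf : MemLp f 2 μ) (hg : MemLp g 2 μ) :
    |∫ x, ⟪f x, g x⟫_ℝ ∂μ| ≤ (eLpNorm f 2 μ).toReal * (eLpNorm g 2 μ).toReal := by
  rw [integral_inner_eq_inner_toLp hf hg, ← Lp.norm_toLp f hf, ← Lp.norm_toLp g hg]
  exact abs_real_inner_le_norm _ _

lemma tendsto_integral_inner {f : ℕ → α → F} {f₀ g : α → F} (hf : ∀ n, MemLp (f n) 2 μ)
    (hf₀ : MemLp f₀ 2 μ) (hg : MemLp g 2 μ)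
    (h : Tendsto (fun n => eLpNorm (fun x => f n x - f₀ x) 2 μ) atTop (𝓝 0)) :
    Tendsto (fun n => ∫ x, ⟪f n x, g x⟫_ℝ ∂μ) atTop (𝓝 (∫ x, ⟪f₀ x, g x⟫_ℝ ∂μ)) := by
  simp_rw [fun n => integral_inner_eq_inner_toLp (hf n) hg]
  rw [integral_inner_eq_inner_toLp hf₀ hg]
  exact ((Lp.tendsto_Lp_iff_tendsto_eLpNorm'' f hf f₀ hf₀).2 h).inner tendsto_const_nhds

end L2

lemma memLp_of_continuous {F : Type*} [NormedAddCommGroup F] {f : Pt d → F} (hf : Continuous f)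
    {μ : Measure (Pt d)} {S : Set (Pt d)} (hS : Bornology.IsBounded S) (hμ : μ S < ∞) :
    MemLp f 2 (μ.restrict S) := by
  have : IsFiniteMeasure (μ.restrict S) := ⟨by simpa using hμ⟩
  obtain ⟨C, hC⟩ := hS.isCompact_closure.exists_bound_of_continuousOn hf.continuousOn
  refine MemLp.of_bound hf.aestronglyMeasurable C ?_
  have : ∀ᵐ x ∂(μ.restrict (closure S)), ‖f x‖ ≤ C :=
    (ae_restrict_iff' isClosed_closure.measurableSet).2 (ae_of_all _ hC)
  exact ae_mono (Measure.restrict_mono subset_closure le_rfl) this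

/-! ### Traces on faces -/

lemma continuous_gradient {ψ : Pt d → ℝ} (hψ : ContDiff ℝ 1 ψ) : Continuous (gradient ψ) :=
  (InnerProductSpace.toDual ℝ (Pt d)).symm.continuous.comp (hψ.continuous_fderiv (by norm_num))

/-- The trace inequality for smooth functions. -/
lemma IsOpposite.exists_trace_le {T E : Finset (Pt d)} {p : Pt d} {h : ℝ}
    (ho : IsOpposite T E p h) (hd : 1 ≤ d) :
    ∃ C : ℝ≥0∞, C ≠ ∞ ∧ ∀ ψ : Pt d → ℝ, ContDiff ℝ 1 ψ →
      eLpNorm ψ 2 ((surf d).restrict (hull E)) ≤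
        C * (eLpNorm ψ 2 (volume.restrict (hull T)) +
          eLpNorm (gradient ψ) 2 (volume.restrict (hull T))) := by
  obtain ⟨M, hM⟩ := (isCompact_hull T).exists_bound_of_continuousOn
    (f := fun x => x - p) (by fun_prop)
  have hM0 : 0 ≤ M := (norm_nonneg _).trans (hM p (subset_hull T ho.mem))
  -- The constant comes from the Green formula for `ψ²`: with `|x - p| ≤ M`, the term `2 ψ ∇ψ·(x -
  -- p)` is at most `ψ² + M² |∇ψ|²`, and division by `h` isolates the face integral.
  set K : ℝ := (d + 1 + M ^ 2) / h with hK
  have hK0 : 0 ≤ K := div_nonneg (by positivity) ho.pos.le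
  refine ⟨ENNReal.ofReal (√K), ENNReal.ofReal_ne_top, fun ψ hψ => ?_⟩
  have hT := isCompact_hull T
  have hgc := continuous_gradient hψ
  have hψc := hψ.continuous
  have hfc : Continuous (fderiv ℝ ψ) := hψ.continuous_fderiv (by norm_num)
  have hL1 := memLp_of_continuous hψc hT.isBounded (μ := volume) hT.measure_lt_top
  have hL2 := memLp_of_continuous hgc hT.isBounded (μ := volume) hT.measure_lt_top
  have hL3 := memLp_of_continuous hψc (isCompact_hull E).isBounded (ho.surf_lt_top hd)
  have hgreen := ho.green hd (hψ.pow 2)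
  have hI {F : Pt d → ℝ} (hF : Continuous F) : IntegrableOn F (hull T) :=
    hF.continuousOn.integrableOn_compact hT
  have hle : ∫ x in hull T, (d * (fun x => ψ x ^ 2) x + fderiv ℝ (fun x => ψ x ^ 2) x (x - p)) ≤
      (d + 1 + M ^ 2) * ((∫ x in hull T, ‖ψ x‖ ^ 2) + ∫ x in hull T, ‖gradient ψ x‖ ^ 2) := by
    rw [← integral_add (hI (by fun_prop)) (hI (by fun_prop)), ← integral_const_mul]
    have hc : Continuous (fderiv ℝ fun x => ψ x ^ 2) :=
      (hψ.pow 2).continuous_fderiv (by norm_num)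
    refine setIntegral_mono_on (hI (by fun_prop)) (hI (by fun_prop)) hT.measurableSet ?_
    intro x hx
    have h1 : fderiv ℝ (fun x => ψ x ^ 2) x (x - p) = 2 * ψ x * ⟪gradient ψ x, x - p⟫_ℝ := by
      rw [inner_gradient_left, fderiv_fun_pow 2 (hψ.differentiable (by norm_num) x)]
      simp
    have h2 : |⟪gradient ψ x, x - p⟫_ℝ| ≤ ‖gradient ψ x‖ * M :=
      (abs_real_inner_le_norm _ _).trans (by gcongr; exact hM x hx)
    have h3 : ⟪gradient ψ x, x - p⟫_ℝ ^ 2 ≤ (‖gradient ψ x‖ * M) ^ 2 := by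
      rw [← sq_abs]; gcongr
    rw [h1, Real.norm_eq_abs, sq_abs]
    have hdn : (0 : ℝ) ≤ d := d.cast_nonneg
    nlinarith [sq_nonneg (ψ x - ⟪gradient ψ x, x - p⟫_ℝ), sq_nonneg (‖gradient ψ x‖),
      mul_nonneg hdn (sq_nonneg ‖gradient ψ x‖), mul_nonneg (sq_nonneg M) (sq_nonneg (ψ x))]
  have hA : ∫ x in hull E, ‖ψ x‖ ^ 2 ∂(surf d) ≤
      K * ((∫ x in hull T, ‖ψ x‖ ^ 2) + ∫ x in hull T, ‖gradient ψ x‖ ^ 2) := by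
    rw [hK, div_mul_eq_mul_div, le_div_iff₀ ho.pos]
    simp only [Real.norm_eq_abs, sq_abs] at hle ⊢
    linarith
  refine (ENNReal.pow_le_pow_left_iff (n := 2) (by norm_num)).1 ?_
  rw [mul_pow, eLpNorm_two_sq_eq_ofReal hL3, ← ENNReal.ofReal_pow (by positivity),
    Real.sq_sqrt hK0]
  calc _ ≤ ENNReal.ofReal (K *
        ((∫ x in hull T, ‖ψ x‖ ^ 2) + ∫ x in hull T, ‖gradient ψ x‖ ^ 2)) :=
        ENNReal.ofReal_le_ofReal hA
    _ = ENNReal.ofReal K * (eLpNorm ψ 2 (volume.restrict (hull T)) ^ 2 +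
          eLpNorm (gradient ψ) 2 (volume.restrict (hull T)) ^ 2) := by
        rw [ENNReal.ofReal_mul hK0, ENNReal.ofReal_add (by positivity) (by positivity),
          eLpNorm_two_sq_eq_ofReal hL1, eLpNorm_two_sq_eq_ofReal hL2]
    _ ≤ _ := by
        gcongr
        rw [add_sq, add_right_comm]
        exact le_self_add

/-- The functions `φ n`, smooth up to the boundary, tend to `u` in `H¹(D)`. -/
structure IsSmoothApprox (D : Set (Pt d)) (u : Pt d → ℝ) (G : Pt d → Pt d)
    (φ : ℕ → Pt d → ℝ) : Prop where
  smooth : ∀ n, ContDiff ℝ (⊤ : ℕ∞) (φ n)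
  tendsto : Tendsto (fun n => eLpNorm (fun x => φ n x - u x) 2 (volume.restrict D)) atTop (𝓝 0)
  tendsto_gradient :
    Tendsto (fun n => eLpNorm (fun x => gradient (φ n) x - G x) 2 (volume.restrict D))
      atTop (𝓝 0)

lemma eLpNorm_sub_le_add {α F : Type*} [MeasurableSpace α] [NormedAddCommGroup F]
    {μ : Measure α} {f g k : α → F} (hf : MemLp f 2 μ) (hg : MemLp g 2 μ) (hk : MemLp k 2 μ) :
    eLpNorm (f - g) 2 μ ≤ eLpNorm (fun x => f x - k x) 2 μ + eLpNorm (fun x => g x - k x) 2 μ := by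
  have h1 : f - g = (f - k) - (g - k) := by abel
  rw [h1]
  exact eLpNorm_sub_le (hf.sub hk).1 (hg.sub hk).1 (by norm_num)

lemma restrict_hull_le {D : Set (Pt d)} {T : Finset (Pt d)} (hTD : elt T ⊆ D) :
    (volume : Measure (Pt d)).restrict (hull T) ≤ volume.restrict D := by
  rw [← restrict_elt]
  exact Measure.restrict_mono hTD le_rfl

lemma gradient_sub_of_differentiable {f g : Pt d → ℝ} (hf : Differentiable ℝ f) (hg : Differentiable ℝ g) :
    gradient (f - g) = gradient f - gradient g := by
  funext x
  simp only [gradient, Pi.sub_apply]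
  rw [fderiv_sub (hf x) (hg x), map_sub]

/-- Functions in `H¹(D)` that are limits of smooth ones have traces on the faces of elements. -/
lemma IsOpposite.exists_hasTrace {D : Set (Pt d)} (hDb : Bornology.IsBounded D)
    {T E : Finset (Pt d)} {p : Pt d} {h : ℝ} (ho : IsOpposite T E p h) (hd : 1 ≤ d)
    (hTD : elt T ⊆ D) {u : Pt d → ℝ} {G : Pt d → Pt d} (hu : MemH1 D u G)
    {φ : ℕ → Pt d → ℝ} (hφ : IsSmoothApprox D u G φ) : ∃ γ, HasTrace D (hull E) u γ := by
  obtain ⟨C, hC, htr⟩ := ho.exists_trace_le hd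
  have hφ1 : ∀ n, ContDiff ℝ 1 (φ n) := fun n => (hφ.smooth n).of_le (by simp)
  have hφd : ∀ n, Differentiable ℝ (φ n) := fun n => (hφ1 n).differentiable (by norm_num)
  have hDv : volume D < ∞ := hDb.measure_lt_top
  have hL1 := fun n => memLp_of_continuous (hφ1 n).continuous hDb hDv
  have hL2 := fun n => memLp_of_continuous (continuous_gradient (hφ1 n)) hDb hDv
  have hL3 := fun n => memLp_of_continuous (hφ1 n).continuous (isCompact_hull E).isBounded
    (ho.surf_lt_top hd)
  obtain ⟨γ, hγ, hlim⟩ := exists_limit_of_eLpNorm_le hL3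
    (c := fun n => C * (eLpNorm (fun x => φ n x - u x) 2 (volume.restrict D) +
      eLpNorm (fun x => gradient (φ n) x - G x) 2 (volume.restrict D))) (by
      have := ENNReal.Tendsto.const_mul (hφ.tendsto.add hφ.tendsto_gradient) (Or.inr hC)
      simpa using this) (by
      intro n m
      -- The trace inequality for the differences makes the restrictions to the face a Cauchy
      -- sequence in `L²`.
      refine (htr _ ((hφ1 n).sub (hφ1 m))).trans ?_
      rw [← mul_add]
      refine mul_le_mul' le_rfl ?_
      rw [← Pi.sub_def, gradient_sub_of_differentiable (hφd n) (hφd m)]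
      refine (add_le_add (eLpNorm_mono_measure _ (restrict_hull_le hTD))
        (eLpNorm_mono_measure _ (restrict_hull_le hTD))).trans ?_
      refine (add_le_add (eLpNorm_sub_le_add (hL1 n) (hL1 m) hu.memL2)
        (eLpNorm_sub_le_add (hL2 n) (hL2 m) hu.grad_memL2)).trans (le_of_eq ?_)
      ring)
  exact ⟨γ, hγ, G, hu, φ, hφ.smooth, hφ.tendsto, hφ.tendsto_gradient, hlim⟩

lemma tendsto_eLpNorm_of_le {α F : Type*} [MeasurableSpace α] [NormedAddCommGroup F]
    {μ ν : Measure α} (hμ : μ ≤ ν) {f : ℕ → α → F}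
    (h : Tendsto (fun n => eLpNorm (f n) 2 ν) atTop (𝓝 0)) :
    Tendsto (fun n => eLpNorm (f n) 2 μ) atTop (𝓝 0) :=
  tendsto_of_tendsto_of_tendsto_of_le_of_le tendsto_const_nhds h (fun _ => zero_le)
    fun _ => eLpNorm_mono_measure _ hμ

/-- The weak gradient is unique. -/
lemma MemH1.gradient_ae_eq {D : Set (Pt d)} (hDo : IsOpen D) (hDb : Bornology.IsBounded D)
    {u : Pt d → ℝ} {G G' : Pt d → Pt d} (hG : MemH1 D u G) (hG' : MemH1 D u G') :
    G =ᵐ[volume.restrict D] G' := by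
  have hDv : volume D < ∞ := hDb.measure_lt_top
  have hfin : IsFiniteMeasure ((volume : Measure (Pt d)).restrict D) := ⟨by simpa using hDv⟩
  have hsub : MemLp (G - G') 2 (volume.restrict D) := hG.grad_memL2.sub hG'.grad_memL2
  have hint : IntegrableOn (G - G') D := hsub.integrable (by norm_num)
  have := hDo.ae_eq_zero_of_integral_contDiff_smul_eq_zero (μ := volume) (f := G - G')
    hint.locallyIntegrableOn ?_
  · refine (ae_restrict_iff' hDo.measurableSet).2 ?_
    filter_upwards [this] with x hx hxD
    exact sub_eq_zero.1 (hx hxD)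
  · intro χ hχ hχc hχD
    have hts : IsTestFunction D χ := ⟨hχ, hχc, hχD⟩
    have hχL : MemLp χ 2 (volume.restrict D) := memLp_of_continuous hχ.continuous hDb hDv
    have hzero : ∀ x, x ∉ D → χ x • (G - G') x = 0 := by
      intro x hx
      rw [image_eq_zero_of_notMem_tsupport fun h => hx (hχD h), zero_smul]
    rw [← setIntegral_eq_integral_of_forall_compl_eq_zero hzero]
    refine ext_inner_right ℝ fun e => ?_
    have hI : Integrable (fun x => χ x • (G - G') x) (volume.restrict D) := by
      exact memLp_one_iff_integrable.1 (hsub.smul hχL)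
    rw [inner_zero_left, real_inner_comm, ← integral_inner hI]
    have h1 := hG.weak χ hts e
    have h2 := hG'.weak χ hts e
    have hin {H : Pt d → Pt d} (hH : MemLp H 2 (volume.restrict D)) :
        Integrable (fun x => ⟪H x, e⟫_ℝ * χ x) (volume.restrict D) := by
      have : Integrable (fun x => ⟪H x, χ x • e⟫_ℝ) (volume.restrict D) :=
        integrable_inner_of_memLp hH
          (memLp_of_continuous (hχ.continuous.smul continuous_const) hDb hDv)
      simpa [inner_smul_right, mul_comm] using this
    have h3 : ∀ x, ⟪e, χ x • (G - G') x⟫_ℝ = ⟪G x, e⟫_ℝ * χ x - ⟪G' x, e⟫_ℝ * χ x := by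
      intro x
      rw [inner_smul_right, Pi.sub_apply, inner_sub_right, real_inner_comm e, real_inner_comm e]
      ring
    simp only [h3]
    rw [integral_sub (hin hG.grad_memL2) (hin hG'.grad_memL2)]
    linarith

/-- The Green formula on an element for functions with a trace on the face. -/
lemma IsOpposite.green_of_hasTrace {D : Set (Pt d)} (hDo : IsOpen D)
    (hDb : Bornology.IsBounded D) {T E : Finset (Pt d)} {p : Pt d} {h : ℝ}
    (ho : IsOpposite T E p h) (hd : 1 ≤ d) (hTD : elt T ⊆ D) {u γ : Pt d → ℝ} {G : Pt d → Pt d}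
    (hu : MemH1 D u G) (htr : HasTrace D (hull E) u γ) :
    d * (∫ x in hull T, u x) + ∫ x in hull T, ⟪G x, x - p⟫_ℝ =
      h * ∫ x in hull E, γ x ∂(surf d) := by
  obtain ⟨hγ, G', hu', φ, hφs, hφ1, hφ2, hφ3⟩ := htr
  have hle := restrict_hull_le hTD
  -- The trace carries a weak gradient of its own, which must be identified with the given one.
  have hGG : G =ᵐ[volume.restrict (hull T)] G' :=
    ae_mono hle (hu.gradient_ae_eq hDo hDb hu')
  have hφC : ∀ n, ContDiff ℝ 1 (φ n) := fun n => (hφs n).of_le (by simp)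
  have hT := isCompact_hull T
  have hEs := ho.surf_lt_top hd
  have hEb := (isCompact_hull E).isBounded
  have hpL := memLp_of_continuous (f := fun x : Pt d => x - p) (by fun_prop) hT.isBounded
    (μ := volume) hT.measure_lt_top
  have h1L := memLp_of_continuous (f := fun _ : Pt d => (1 : ℝ)) (by fun_prop) hT.isBounded
    (μ := volume) hT.measure_lt_top
  have h1E := memLp_of_continuous (f := fun _ : Pt d => (1 : ℝ)) (by fun_prop) hEb hEs
  have hL1 := fun n => memLp_of_continuous (hφC n).continuous hT.isBounded
    (μ := volume) hT.measure_lt_top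
  have hL2 := fun n => memLp_of_continuous (continuous_gradient (hφC n)) hT.isBounded
    (μ := volume) hT.measure_lt_top
  have hL3 := fun n => memLp_of_continuous (hφC n).continuous hEb hEs
  have t1 := tendsto_integral_inner hL1 (hu.memL2.mono_measure hle) h1L
    (tendsto_eLpNorm_of_le hle hφ1)
  have t2 := tendsto_integral_inner hL2 (hu'.grad_memL2.mono_measure hle) hpL
    (tendsto_eLpNorm_of_le hle hφ2)
  have t3 := tendsto_integral_inner hL3 hγ h1E hφ3
  have hG : ∫ x in hull T, ⟪G x, x - p⟫_ℝ = ∫ x in hull T, ⟪G' x, x - p⟫_ℝ := by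
    refine integral_congr_ae ?_
    filter_upwards [hGG] with x hx
    rw [hx]
  simp only [RCLike.inner_apply, conj_trivial, one_mul] at t1 t3
  rw [hG]
  refine tendsto_nhds_unique ((t1.const_mul (d : ℝ)).add t2) ((t3.const_mul h).congr fun n => ?_)
  rw [← ho.green hd (hφC n), integral_add, integral_const_mul]
  · simp only [inner_gradient_left]
  · exact ((hφC n).continuous.continuousOn.integrableOn_compact hT).const_mul _
  · have := (integrable_inner_of_memLp (hL2 n) hpL)
    simpa only [inner_gradient_left] using this

/-! ### Regularity of the mixed solution -/

lemma aMin_le {D : Set (Pt d)} (hDb : Bornology.IsBounded D) {a : Pt d → ℝ}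
    (ha : ContinuousOn a (closure D)) {x : Pt d} (hx : x ∈ D) : aMin D a ≤ a x :=
  csInf_le (hDb.isCompact_closure.bddBelow_image ha)
    (Set.mem_image_of_mem a (subset_closure hx))

/-- Division by the coefficient preserves square integrability. -/
lemma memL2_inv_smul {D : Set (Pt d)} (hDo : IsOpen D) (hDb : Bornology.IsBounded D)
    {a : Pt d → ℝ} (ha : ContinuousOn a (closure D)) (hpos : 0 < aMin D a) {q : Pt d → Pt d}
    (hq : MemL2 D q) : MemL2 D (fun x => (a x)⁻¹ • q x) := by
  have hm : AEStronglyMeasurable (fun x => (a x)⁻¹) (volume.restrict D) :=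
    ContinuousOn.aestronglyMeasurable ((ha.mono subset_closure).inv₀ fun x hx =>
      (hpos.trans_le (aMin_le hDb ha hx)).ne') hDo.measurableSet
  refine MemLp.of_le_mul (c := (aMin D a)⁻¹) hq (hm.smul hq.1) ?_
  refine (ae_restrict_iff' hDo.measurableSet).2 (ae_of_all _ fun x hx => ?_)
  have h1 := aMin_le hDb ha hx
  rw [norm_smul, norm_inv, Real.norm_eq_abs, abs_of_pos (hpos.trans_le h1)]
  gcongr

lemma norm_inv_smul_le {D : Set (Pt d)} (hDb : Bornology.IsBounded D)
    {a : Pt d → ℝ} (ha : ContinuousOn a (closure D)) (hpos : 0 < aMin D a) {x : Pt d}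
    (hx : x ∈ D) (v : Pt d) : ‖(a x)⁻¹ • v‖ ≤ (aMin D a)⁻¹ * ‖v‖ := by
  have h1 := aMin_le hDb ha hx
  rw [norm_smul, norm_inv, Real.norm_eq_abs, abs_of_pos (hpos.trans_le h1)]
  gcongr

/-- Smooth fields `φ e` belong to `H(div, D)`. -/
lemma memHdiv_smul_const {D : Set (Pt d)} (hDb : Bornology.IsBounded D) {φ : Pt d → ℝ}
    (hφ : ContDiff ℝ (⊤ : ℕ∞) φ) (e : Pt d) :
    MemHdiv D (fun x => φ x • e) (fun x => fderiv ℝ φ x e) := by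
  have hfc : Continuous fun x => fderiv ℝ φ x e :=
    (hφ.continuous_fderiv (by simp)).clm_apply continuous_const
  refine ⟨memLp_of_continuous (hφ.continuous.smul continuous_const) hDb hDb.measure_lt_top,
    memLp_of_continuous hfc hDb hDb.measure_lt_top, fun χ hχ => ?_⟩
  have hcc : Continuous fun x => fderiv ℝ χ x e :=
    (hχ.smooth.continuous_fderiv (by simp)).clm_apply continuous_const
  have hsupp : HasCompactSupport fun x => fderiv ℝ χ x e := hχ.compact.fderiv_apply ℝ e
  have h0 : ∀ x, x ∉ D → χ x = 0 := fun x hx =>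
    image_eq_zero_of_notMem_tsupport fun h => hx (hχ.subset h)
  have h0' : ∀ x, x ∉ D → fderiv ℝ χ x = 0 := fun x hx => by
    by_contra hne
    exact hx (hχ.subset (support_fderiv_subset ℝ hne))
  -- Only `χ` has compact support in `D`; it lets both integrals be taken over the whole space,
  -- where integration by parts has no boundary term.
  rw [setIntegral_eq_integral_of_forall_compl_eq_zero (fun x hx => by simp [h0' x hx]),
    setIntegral_eq_integral_of_forall_compl_eq_zero (fun x hx => by simp [h0 x hx])]
  simp only [map_smul, smul_eq_mul]
  refine integral_mul_fderiv_eq_neg_fderiv_mul_of_integrable ?_ ?_ ?_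
    (fun x _ => hφ.differentiable (by simp) x) (fun x _ => hχ.smooth.differentiable (by simp) x)
  · exact (hfc.mul hχ.smooth.continuous).integrable_of_hasCompactSupport hχ.compact.mul_left
  · exact (hφ.continuous.mul hcc).integrable_of_hasCompactSupport hsupp.mul_left
  · exact (hφ.continuous.mul hχ.smooth.continuous).integrable_of_hasCompactSupport
      hχ.compact.mul_left

lemma gradient_add_of_differentiable {f g : Pt d → ℝ} (hf : Differentiable ℝ f) (hg : Differentiable ℝ g) :
    gradient (f + g) = gradient f + gradient g := by
  funext x
  simp only [gradient, Pi.add_apply]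
  rw [fderiv_add (hf x) (hg x), map_add]

lemma tendsto_eLpNorm_add {α F : Type*} [MeasurableSpace α] [NormedAddCommGroup F]
    {μ : Measure α} {f g : ℕ → α → F} {f₀ g₀ : α → F} (hf : ∀ n, MemLp (f n) 2 μ)
    (hg : ∀ n, MemLp (g n) 2 μ) (hf₀ : MemLp f₀ 2 μ) (hg₀ : MemLp g₀ 2 μ)
    (h1 : Tendsto (fun n => eLpNorm (fun x => f n x - f₀ x) 2 μ) atTop (𝓝 0))
    (h2 : Tendsto (fun n => eLpNorm (fun x => g n x - g₀ x) 2 μ) atTop (𝓝 0)) :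
    Tendsto (fun n => eLpNorm (fun x => (f n + g n) x - (f₀ + g₀) x) 2 μ) atTop (𝓝 0) := by
  have h3 := h1.add h2
  rw [add_zero] at h3
  refine tendsto_of_tendsto_of_tendsto_of_le_of_le tendsto_const_nhds h3 (fun _ => zero_le)
    fun n => ?_
  have h4 : (fun x => (f n + g n) x - (f₀ + g₀) x) =
      (fun x => f n x - f₀ x) + fun x => g n x - g₀ x := by
    funext x
    simp only [Pi.add_apply]
    abel
  beta_reduce
  rw [h4]
  exact eLpNorm_add_le ((hf n).sub hf₀).1 ((hg n).sub hg₀).1 (by norm_num)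

/-- The solution of the mixed problem belongs to `H¹(D)`, with gradient `g - a⁻¹ q`, and is a limit
of smooth functions. -/
lemma IsMixedSolution.exists_isSmoothApprox {D : Set (Pt d)} (hDo : IsOpen D)
    (hDb : Bornology.IsBounded D) {a : Pt d → ℝ} {g : Pt d → Pt d} {f uΓ : Pt d → ℝ}
    {q : Pt d → Pt d} {u : Pt d → ℝ} (ha : ContinuousOn a (closure D)) (hpos : 0 < aMin D a)
    (hg : MemL2 D g) (hs : IsMixedSolution D a g f uΓ q u) :
    MemH1 D u (fun x => g x - (a x)⁻¹ • q x) ∧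
      ∃ φ, IsSmoothApprox D u (fun x => g x - (a x)⁻¹ • q x) φ := by
  obtain ⟨U, GU, hU, ⟨-, GU', hU', φ, hφs, hφ1, hφ2, -⟩, hfirst⟩ := hs.first
  obtain ⟨dq, hq, -⟩ := hs.second
  have hDv : volume D < ∞ := hDb.measure_lt_top
  have hu := hs.u_memL2
  have haq := memL2_inv_smul hDo hDb ha hpos hq.memL2
  set z : Pt d → Pt d := fun x => g x - (a x)⁻¹ • q x with hz
  have hzL : MemL2 D z := hg.sub haq
  have hwL : MemL2 D (u - U) := hu.sub hU.memL2
  have hZL : MemL2 D (z - GU) := hzL.sub hU.grad_memL2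
  -- The mixed equation is tested with the field `χ e`. Since `χ` need not vanish on the boundary,
  -- the identity also encodes that `u - U` has zero boundary values.
  have key : ∀ χ : Pt d → ℝ, ContDiff ℝ (⊤ : ℕ∞) χ → ∀ e : Pt d,
      ∫ x in D, (u - U) x * fderiv ℝ χ x e = -∫ x in D, ⟪(z - GU) x, e⟫_ℝ * χ x := by
    intro χ hχ e
    have hd1 : MemL2 D (fun x => fderiv ℝ χ x e) :=
      memLp_of_continuous ((hχ.continuous_fderiv (by simp)).clm_apply continuous_const) hDb hDv
    have hd2 : MemL2 D (fun x => χ x • e) :=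
      memLp_of_continuous (hχ.continuous.smul continuous_const) hDb hDv
    have h1 := hfirst _ _ (memHdiv_smul_const hDb hχ e)
    have i1 := integrable_mul_of_memLp hd1 hu
    have i2 := integrable_mul_of_memLp hU.memL2 hd1
    have i3 : Integrable (fun x => (a x)⁻¹ * ⟪q x, χ x • e⟫_ℝ) (volume.restrict D) := by
      simpa only [real_inner_smul_left] using integrable_inner_of_memLp haq hd2
    have i4 := integrable_inner_of_memLp hg hd2
    have i5 := integrable_inner_of_memLp hU.grad_memL2 hd2
    have i8 : Integrable (fun x => U x * fderiv ℝ χ x e + ⟪GU x, χ x • e⟫_ℝ)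
        (volume.restrict D) := i2.add i5
    rw [← integral_sub i3 i1, ← integral_sub i4 i8] at h1
    have h2 : ∫ x in D, (((a x)⁻¹ * ⟪q x, χ x • e⟫_ℝ - fderiv ℝ χ x e * u x) -
        (⟪g x, χ x • e⟫_ℝ - (U x * fderiv ℝ χ x e + ⟪GU x, χ x • e⟫_ℝ))) = 0 := by
      exact (integral_sub (i3.sub i1) (i4.sub i8)).trans (sub_eq_zero.2 h1)
    have i6 := integrable_mul_of_memLp hwL hd1
    have i7 : Integrable (fun x => ⟪(z - GU) x, e⟫_ℝ * χ x) (volume.restrict D) := by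
      have := integrable_inner_of_memLp hZL hd2
      simpa [inner_smul_right, mul_comm] using this
    rw [eq_neg_iff_add_eq_zero, ← integral_add i6 i7, ← neg_eq_zero, ← integral_neg, ← h2]
    refine integral_congr_ae (ae_of_all _ fun x => ?_)
    simp only [hz, Pi.sub_apply, inner_sub_left, inner_smul_right, real_inner_smul_left]
    ring
  -- For compactly supported `χ`, adding the weak identity of `U` removes `U` again.
  have hH1 : MemH1 D u z := by
    refine ⟨hu, hzL, fun χ hχ e => ?_⟩
    have hd1 : MemL2 D (fun x => fderiv ℝ χ x e) := memLp_of_continuous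
      ((hχ.smooth.continuous_fderiv (by simp)).clm_apply continuous_const) hDb hDv
    have hd2 : MemL2 D (fun x => χ x • e) :=
      memLp_of_continuous (hχ.smooth.continuous.smul continuous_const) hDb hDv
    have hin {H : Pt d → Pt d} (hH : MemL2 D H) :
        Integrable (fun x => ⟪H x, e⟫_ℝ * χ x) (volume.restrict D) := by
      have := integrable_inner_of_memLp hH hd2
      simpa [inner_smul_right, mul_comm] using this
    have h1 := key χ hχ.smooth e
    have h2 := hU.weak χ hχ e
    simp only [Pi.sub_apply, sub_mul, inner_sub_left] at h1
    rw [integral_sub (integrable_mul_of_memLp hu hd1) (integrable_mul_of_memLp hU.memL2 hd1),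
      integral_sub (hin hzL) (hin hU.grad_memL2)] at h1
    linarith
  refine ⟨hH1, ?_⟩
  have hGG := hU'.gradient_ae_eq hDo hDb hU
  -- By `key`, the extensions by zero of `u - U` and `z - GU` form a function and its weak gradient
  -- on the whole space.
  obtain ⟨ψ, hψs, hψ1, hψ2⟩ := exists_smooth_approx hDb
    ((memLp_indicator_iff_restrict hDo.measurableSet).2 hwL)
    ((memLp_indicator_iff_restrict hDo.measurableSet).2 hZL) (by
      intro χ hχ e
      have h1 := key χ hχ.smooth e
      rw [← integral_indicator hDo.measurableSet, ← integral_indicator hDo.measurableSet] at h1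
      refine Eq.trans (integral_congr_ae (ae_of_all _ fun x => ?_))
        (h1.trans (congrArg Neg.neg (integral_congr_ae (ae_of_all _ fun x => ?_))))
      · by_cases hx : x ∈ D <;> simp [hx]
      · by_cases hx : x ∈ D <;> simp [hx])
  have hψ1' : Tendsto (fun n => eLpNorm (fun x => ψ n x - (u - U) x) 2 (volume.restrict D))
      atTop (𝓝 0) := by
    refine hψ1.congr fun n => eLpNorm_congr_ae ?_
    refine (ae_restrict_iff' hDo.measurableSet).2 (ae_of_all _ fun x hx => ?_)
    simp only [Set.indicator_of_mem hx]
  have hψ2' : Tendsto (fun n => eLpNorm (fun x => gradient (ψ n) x - (z - GU) x) 2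
      (volume.restrict D)) atTop (𝓝 0) := by
    refine hψ2.congr fun n => eLpNorm_congr_ae ?_
    refine (ae_restrict_iff' hDo.measurableSet).2 (ae_of_all _ fun x hx => ?_)
    simp only [Set.indicator_of_mem hx]
  have hφ2' : Tendsto (fun n => eLpNorm (fun x => gradient (φ n) x - GU x) 2
      (volume.restrict D)) atTop (𝓝 0) := by
    refine hφ2.congr fun n => eLpNorm_congr_ae ?_
    filter_upwards [hGG] with x hx
    rw [hx]
  have hφC : ∀ n, ContDiff ℝ 1 (φ n) := fun n => (hφs n).of_le (by simp)
  have hψC : ∀ n, ContDiff ℝ 1 (ψ n) := fun n => (hψs n).of_le (by simp)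
  -- Here `φ n` tends to `U`, by the definition of its trace, and `ψ n` tends to `u - U`.
  refine ⟨fun n => φ n + ψ n, fun n => (hφs n).add (hψs n), ?_, ?_⟩
  · have := tendsto_eLpNorm_add (fun n => memLp_of_continuous (hφC n).continuous hDb hDv)
      (fun n => memLp_of_continuous (hψC n).continuous hDb hDv) hU.memL2 hwL hφ1 hψ1'
    simpa only [add_sub_cancel] using this
  · have := tendsto_eLpNorm_add
      (fun n => memLp_of_continuous (continuous_gradient (hφC n)) hDb hDv)
      (fun n => memLp_of_continuous (continuous_gradient (hψC n)) hDb hDv)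
      hU.grad_memL2 hZL hφ2' hψ2'
    rw [add_sub_cancel] at this
    simpa only [gradient_add_of_differentiable ((hφC _).differentiable (by norm_num))
      ((hψC _).differentiable (by norm_num))] using this

/-! ### The local identity for the multiplier -/

lemma isRT0_zero : IsRT0 (0 : Pt d → Pt d) := ⟨0, 0, fun x => by simp⟩

lemma isRT0_sub (p : Pt d) : IsRT0 (fun x => x - p) :=
  ⟨-p, 1, fun x => by simp [sub_eq_neg_add]⟩

lemma IsRT0.continuous {v : Pt d → Pt d} (hv : IsRT0 v) : Continuous v := by
  obtain ⟨α, β, h⟩ := hv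
  rw [funext h]
  fun_prop

lemma divergence_sub (p x : Pt d) : divergence (fun x => x - p) x = d := by
  simp only [divergence, fderiv_sub_const, fderiv_fun_id]
  simp

lemma divergence_zero (x : Pt d) : divergence (0 : Pt d → Pt d) x = 0 := by
  simp [divergence]

/-- The first discrete equation, tested with the Raviart-Thomas field of one face of one element. -/
lemma IsHybridSolution.local_identity {D : Set (Pt d)} {𝒯 : Triangulation D} {a : Pt d → ℝ}
    {g : Pt d → Pt d} {f uΓ : Pt d → ℝ} {qh : Finset (Pt d) → Pt d → Pt d}
    {uh lam : Finset (Pt d) → ℝ} (hs : IsHybridSolution 𝒯 a g f uΓ qh uh lam)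
    {T E : Finset (Pt d)} {p : Pt d} {h : ℝ} (ho : IsOpposite T E p h) (hT : T ∈ 𝒯.cells)
    (hE : E ∈ facesOf T)
    (hb : ¬ IsBoundaryFace D E ∨ uΓ =ᵐ[(surf d).restrict (hull E)] 0) :
    (∫ x in hull T, (a x)⁻¹ * ⟪qh T x, x - p⟫_ℝ) - d * volume.real (hull T) * uh T +
      lam E * (h * (surf d).real (hull E)) = ∫ x in hull T, ⟪g x, x - p⟫_ℝ := by
  set v : Finset (Pt d) → Pt d → Pt d := fun T' => if T' = T then fun x => x - p else 0 with hv
  have hvT : v T = fun x => x - p := if_pos rfl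
  have hvne : ∀ T' ≠ T, v T' = 0 := fun T' h => if_neg h
  have hrt : ∀ T' ∈ 𝒯.cells, IsRT0 (v T') := by
    intro T' _
    by_cases h : T' = T
    · rw [h, hvT]; exact isRT0_sub p
    · rw [hvne T' h]; exact isRT0_zero
  have h1 := hs.first v hrt
  have hlat : ∀ E' ∈ facesOf T, E' ≠ E → ∀ c : Pt d → ℝ,
      ∫ x in hull E', c x * ⟪x - p, outwardNormal T E'⟫_ℝ ∂(surf d) = 0 := by
    intro E' hE' hne c
    rw [setIntegral_congr_fun (g := fun _ => (0 : ℝ)) (isCompact_hull E').measurableSet]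
    · simp
    · intro x hx
      simp only
      rw [real_inner_comm, ho.lateral E' hE' hne x hx, mul_zero]
  have hint : ∑ E' ∈ interiorFacesOf D T,
      (∫ x in hull E', lam E' * ⟪x - p, outwardNormal T E'⟫_ℝ ∂(surf d)) =
        lam E * (h * (surf d).real (hull E)) := by
    have hval : ∫ x in hull E, lam E * ⟪x - p, outwardNormal T E⟫_ℝ ∂(surf d) =
        lam E * (h * (surf d).real (hull E)) := by
      rw [setIntegral_congr_fun (g := fun _ => lam E * h) (isCompact_hull E).measurableSet]
      · simp
        ring
      · intro x hx
        simp only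
        rw [real_inner_comm, ho.height x hx]
    -- On a boundary face the multiplier is zero, and `E` is missing from the sum, so the formula
    -- holds there as well.
    by_cases hbd : IsBoundaryFace D E
    · rw [hs.lam_boundary E (Finset.mem_biUnion.2 ⟨T, hT, hE⟩) hbd, zero_mul]
      refine Finset.sum_eq_zero fun E' hE' => ?_
      rw [interiorFacesOf, Finset.mem_filter] at hE'
      exact hlat E' hE'.1 (by rintro rfl; exact hE'.2 hbd) fun _ => lam E'
    · have hEi : E ∈ interiorFacesOf D T := Finset.mem_filter.2 ⟨hE, hbd⟩
      rw [Finset.sum_eq_single_of_mem E hEi, hval]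
      intro E' hE' hne
      exact hlat E' (Finset.mem_filter.1 hE').1 hne fun _ => lam E'
  have hbdy : ∑ E' ∈ boundaryFacesOf D T,
      (∫ x in hull E', uΓ x * ⟪x - p, outwardNormal T E'⟫_ℝ ∂(surf d)) = 0 := by
    refine Finset.sum_eq_zero fun E' hE' => ?_
    rw [boundaryFacesOf, Finset.mem_filter] at hE'
    by_cases hne : E' = E
    · subst hne
      refine integral_eq_zero_of_ae ?_
      filter_upwards [hb.resolve_left (not_not.2 hE'.2)] with x hx
      simp [hx]
    · exact hlat E' hE'.1 hne uΓ
  rw [Finset.sum_eq_single_of_mem T hT, Finset.sum_eq_single_of_mem T hT,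
    Finset.sum_eq_single_of_mem T hT, Finset.sum_eq_single_of_mem T hT,
    Finset.sum_eq_single_of_mem T hT] at h1
  · simp only [hvT] at h1
    rw [hint, hbdy, sub_zero] at h1
    simp only [divergence_sub, restrict_elt] at h1
    rw [← h1]
    simp
    ring
  all_goals
    intro T' _ hne
    simp [hvne T' hne, divergence_zero]

/-- The mean values of the multiplier error, of the error of the flux and of the scalar variable
are related on each element. -/
lemma multiplier_identity (hd : 1 ≤ d) {D : Set (Pt d)} (hD : IsLipschitzDomain D)
    {𝒯 : Triangulation D} {a : Pt d → ℝ} {g : Pt d → Pt d} {f uΓ : Pt d → ℝ} {q : Pt d → Pt d}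
    {u : Pt d → ℝ} {qh : Finset (Pt d) → Pt d → Pt d} {uh lam : Finset (Pt d) → ℝ}
    (ha : ContinuousOn a (closure D)) (hpos : 0 < aMin D a) (hg : MemL2 D g) (hq : MemL2 D q)
    (hu : MemH1 D u (fun x => g x - (a x)⁻¹ • q x))
    (hs : IsHybridSolution 𝒯 a g f uΓ qh uh lam)
    {γ : Finset (Pt d) → Pt d → ℝ} {Pγ Pu : Finset (Pt d) → ℝ} (hγ : 𝒯.IsSkeletonTrace u γ)
    (hPγ : 𝒯.IsFaceProjection γ Pγ) (hPu : 𝒯.IsCellProjection u Pu)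
    {T E : Finset (Pt d)} {p : Pt d} {h : ℝ} (ho : IsOpposite T E p h) (hT : T ∈ 𝒯.cells)
    (hE : E ∈ facesOf T)
    (hb : ¬ IsBoundaryFace D E ∨ uΓ =ᵐ[(surf d).restrict (hull E)] 0) :
    h * (surf d).real (hull E) * (lam E - Pγ E) =
      (∫ x in hull T, ⟪(a x)⁻¹ • (q x - qh T x), x - p⟫_ℝ) +
        d * volume.real (hull T) * (uh T - Pu T) := by
  have hTD := 𝒯.elt_subset hD hT
  have hle := restrict_hull_le hTD
  have hEf : E ∈ 𝒯.faces := Finset.mem_biUnion.2 ⟨T, hT, hE⟩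
  have hTc := isCompact_hull T
  have hfin : IsFiniteMeasure ((volume : Measure (Pt d)).restrict (hull T)) :=
    ⟨by simpa using hTc.measure_lt_top⟩
  have hfinE : IsFiniteMeasure ((surf d).restrict (hull E)) :=
    ⟨by simpa using ho.surf_lt_top hd⟩
  have hgreen := ho.green_of_hasTrace hD.isOpen hD.isBounded hd hTD hu (hγ E hEf)
  have hloc := hs.local_identity ho hT hE hb
  have hpu : ∫ x in hull T, u x = Pu T * volume.real (hull T) := by
    -- Testing with the indicator of one cell identifies the projection with the cell mean; faces
    -- are treated in the same way below.
    have h1 := hPu fun T' => if T' = T then 1 else 0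
    rw [Finset.sum_eq_single_of_mem T hT (by intro T' _ hne; simp [hne])] at h1
    simp only [if_true, mul_one, restrict_elt] at h1
    rw [integral_sub ((hu.memL2.mono_measure hle).integrable (by norm_num))
      (integrable_const _)] at h1
    rw [sub_eq_zero.1 h1]
    simp [mul_comm]
  have hpγ : ∫ x in hull E, γ E x ∂(surf d) = Pγ E * (surf d).real (hull E) := by
    have h1 := hPγ fun E' => if E' = E then 1 else 0
    rw [Finset.sum_eq_single_of_mem E hEf (by intro E' _ hne; simp [hne])] at h1
    simp only [if_true, mul_one] at h1
    rw [integral_sub ((hγ E hEf).1.integrable (by norm_num)) (integrable_const _)] at h1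
    rw [sub_eq_zero.1 h1]
    simp [mul_comm]
  have hpL := memLp_of_continuous (f := fun x : Pt d => x - p) (by fun_prop) hTc.isBounded
    (μ := volume) hTc.measure_lt_top
  have haq := (memL2_inv_smul hD.isOpen hD.isBounded ha hpos hq).mono_measure hle
  have haqh := (memL2_inv_smul hD.isOpen hD.isBounded ha hpos
    (memLp_of_continuous (hs.rt T hT).continuous hD.isBounded
      hD.isBounded.measure_lt_top)).mono_measure hle
  have e1 : ∫ x in hull T, ⟪g x - (a x)⁻¹ • q x, x - p⟫_ℝ =
      (∫ x in hull T, ⟪g x, x - p⟫_ℝ) - ∫ x in hull T, ⟪(a x)⁻¹ • q x, x - p⟫_ℝ := by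
    rw [← integral_sub (integrable_inner_of_memLp (hg.mono_measure hle) hpL)
      (integrable_inner_of_memLp haq hpL)]
    simp only [inner_sub_left]
  have e2 : ∫ x in hull T, ⟪(a x)⁻¹ • (q x - qh T x), x - p⟫_ℝ =
      (∫ x in hull T, ⟪(a x)⁻¹ • q x, x - p⟫_ℝ) -
        ∫ x in hull T, (a x)⁻¹ * ⟪qh T x, x - p⟫_ℝ := by
    simp only [← real_inner_smul_left]
    rw [← integral_sub (integrable_inner_of_memLp haq hpL)
      (integrable_inner_of_memLp haqh hpL)]
    simp only [← inner_sub_left, smul_sub]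
  -- The difference of the discrete and the continuous relation: the integrals of `g` cancel.
  rw [hpu, e1, hpγ] at hgreen
  rw [e2]
  linarith

/-! ### From the identity to the estimate -/

lemma normL2_const {F : Type*} [NormedAddCommGroup F] (μ : Measure (Pt d)) (S : Set (Pt d))
    (c : F) : normL2 μ S (fun _ => c) = ‖c‖ * √(μ.real S) := by
  rw [normL2, eLpNorm_const' c (by norm_num) (by norm_num), Measure.restrict_apply_univ,
    ENNReal.toReal_mul, ← ENNReal.toReal_rpow, toReal_enorm, Real.sqrt_eq_rpow]
  simp [Measure.real]

/-- Cauchy-Schwarz on the element, with `a⁻¹` bounded by the inverse of its minimum and `|x - p|` by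
the diameter. -/
lemma abs_integral_flux_le {D : Set (Pt d)} (hD : IsLipschitzDomain D) {a : Pt d → ℝ}
    (ha : ContinuousOn a (closure D)) (hpos : 0 < aMin D a) {v : Pt d → Pt d} (hv : MemL2 D v)
    {T : Finset (Pt d)} (hTD : elt T ⊆ D) (hT : T.card = d + 1)
    (hind : AffineIndependent ℝ ((↑) : T → Pt d)) {p : Pt d} (hp : p ∈ T) :
    |∫ x in hull T, ⟪(a x)⁻¹ • v x, x - p⟫_ℝ| ≤
      (aMin D a)⁻¹ * normL2 volume (elt T) v * (diamT T * √(volume.real (hull T))) := by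
  have hle := restrict_hull_le hTD
  have hTc := isCompact_hull T
  have hfin : IsFiniteMeasure ((volume : Measure (Pt d)).restrict (hull T)) :=
    ⟨by simpa using hTc.measure_lt_top⟩
  have hpL := memLp_of_continuous (f := fun x : Pt d => x - p) (by fun_prop) hTc.isBounded
    (μ := volume) hTc.measure_lt_top
  have hav := (memL2_inv_smul hD.isOpen hD.isBounded ha hpos hv).mono_measure hle
  have hvT := hv.mono_measure hle
  refine (abs_integral_inner_le hav hpL).trans ?_
  have hdiam : 0 ≤ diamT T := Metric.diam_nonneg
  refine mul_le_mul ?_ ?_ ENNReal.toReal_nonneg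
    (mul_nonneg (inv_nonneg.2 hpos.le) ENNReal.toReal_nonneg)
  · rw [normL2, restrict_elt]
    have h1 : eLpNorm (fun x => (a x)⁻¹ • v x) 2 (volume.restrict (hull T)) ≤
        ENNReal.ofReal (aMin D a)⁻¹ * eLpNorm v 2 (volume.restrict (hull T)) := by
      refine eLpNorm_le_mul_eLpNorm_of_ae_le_mul ?_ 2
      rw [← restrict_elt]
      exact (ae_restrict_iff' isOpen_interior.measurableSet).2 (ae_of_all _ fun x hx =>
        norm_inv_smul_le hD.isBounded ha hpos (hTD hx) _)
    have h2 := ENNReal.toReal_mono (ENNReal.mul_ne_top ENNReal.ofReal_ne_top hvT.2.ne) h1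
    rwa [ENNReal.toReal_mul, ENNReal.toReal_ofReal (inv_nonneg.2 hpos.le)] at h2
  · have h1 : eLpNorm (fun x => x - p) 2 (volume.restrict (hull T)) ≤
        eLpNorm (fun _ => diamT T) 2 (volume.restrict (hull T)) := by
      refine eLpNorm_mono_ae ((ae_restrict_iff' hTc.measurableSet).2 (ae_of_all _ fun x hx => ?_))
      rw [← dist_eq_norm, Real.norm_of_nonneg hdiam]
      exact dist_le_diamT hT hind hx (subset_hull T hp)
    have h2 := ENNReal.toReal_mono (memLp_const (diamT T)).2.ne h1
    have h3 := normL2_const volume (hull T) (diamT T)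
    rw [normL2, Real.norm_of_nonneg hdiam] at h3
    rwa [h3] at h2

/-- The elementary inequality behind the estimate of the multiplier. -/
lemma multiplier_bound {n h A V δ m s e c y b I : ℝ} (hn : 1 ≤ n) (hh : 0 < h) (hV : 0 < V)
    (hδ : 0 < δ) (hm : 1 ≤ m) (hA : n * V = h * A) (hδh : δ ≤ m * h)
    (hs : 0 ≤ s * e) (hy : h * A * y = I + n * V * c) (hI : |I| ≤ s * e * (δ * √V))
    (hb : b = √(n * m)) :
    |y| * √A ≤ b * (s * √δ * e + (√δ)⁻¹ * (|c| * √V)) := by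
  -- In the application `n` is the dimension, `h` the height, `A` and `V` the measures of face and
  -- element, `δ` the diameter, `m` the shape constant, `s` the inverse of the minimal coefficient,
  -- `e` the norm of the flux error, `c` and `y` the errors of the scalar variable and the
  -- multiplier.
  have hA0 : 0 < A := by
    by_contra hA'
    have : h * A ≤ 0 := mul_nonpos_of_nonneg_of_nonpos hh.le (not_lt.1 hA')
    nlinarith
  have hsV := Real.sqrt_pos.2 hV
  have hsδ := Real.sqrt_pos.2 hδ
  have hVV : √V * √V = V := Real.mul_self_sqrt hV.le
  have hδδ : √δ * √δ = δ := Real.mul_self_sqrt hδ.le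
  -- Source of the constant `b`: `A δ ≤ m h A = n m V`.
  have h1 : √A * √δ ≤ b * √V := by
    rw [hb, ← Real.sqrt_mul hA0.le, ← Real.sqrt_mul (by positivity)]
    refine Real.sqrt_le_sqrt ?_
    calc A * δ ≤ A * (m * h) := by gcongr
      _ = m * (h * A) := by ring
      _ = n * m * V := by rw [← hA]; ring
  -- The identity is divided by `n V = h A`; the factor `1 / n ≤ 1` in front of the flux term is
  -- discarded.
  have h2 : |y| * V ≤ s * e * (δ * √V) + V * |c| := by
    have h3 : n * V * |y| ≤ s * e * (δ * √V) + n * V * |c| := by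
      have h4 : n * V * |y| = |I + n * V * c| := by
        rw [← hy, ← hA, abs_mul, abs_of_pos (by positivity : 0 < n * V)]
      rw [h4]
      refine (abs_add_le _ _).trans ?_
      rw [abs_mul (n * V), abs_of_pos (by positivity : 0 < n * V)]
      gcongr
    have h5 : 0 ≤ s * e * (δ * √V) := by positivity
    have h6 : n * (|y| * V) ≤ n * (s * e * (δ * √V) + V * |c|) := by nlinarith
    exact le_of_mul_le_mul_left h6 (by linarith)
  have h7 : |y| * √V ≤ s * e * δ + √V * |c| := by
    refine le_of_mul_le_mul_right (a := √V) ?_ hsV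
    calc |y| * √V * √V = |y| * V := by rw [mul_assoc, hVV]
      _ ≤ s * e * (δ * √V) + V * |c| := h2
      _ = (s * e * δ + √V * |c|) * √V := by
        linear_combination (-|c|) * hVV
  have hb0 : 0 ≤ b := hb ▸ Real.sqrt_nonneg _
  refine le_of_mul_le_mul_right (a := √δ) ?_ hsδ
  calc |y| * √A * √δ = |y| * (√A * √δ) := by ring
    _ ≤ |y| * (b * √V) := by gcongr
    _ = b * (|y| * √V) := by ring
    _ ≤ b * (s * e * δ + √V * |c|) := by gcongr
    _ = b * (s * √δ * e + (√δ)⁻¹ * (|c| * √V)) * √δ := by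
      linear_combination (-(b * s * e)) * hδδ - b * √V * |c| * (inv_mul_cancel₀ hsδ.ne')

end MixedFEM

theorem mainTheorem10 (d : ℕ) (hd : d = 2 ∨ d = 3) (γ₀ : ℝ) :
    ∃ C : ℝ, 0 < C ∧
      ∀ (D : Set (Pt d)), IsLipschitzDomain D →
      ∀ (𝒯 : Triangulation D), 𝒯.IsShapeRegular γ₀ →
      ∀ (Ω : Type*) [MeasurableSpace Ω] (P : Measure Ω) [IsProbabilityMeasure P]
        (a : Ω → Pt d → ℝ) (g : Ω → Pt d → Pt d) (f : Ω → Pt d → ℝ) (uΓ : Pt d → ℝ)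
        (q : Ω → Pt d → Pt d) (u : Ω → Pt d → ℝ)
        (qh : Ω → Finset (Pt d) → Pt d → Pt d) (uh lam : Ω → Finset (Pt d) → ℝ),
      (∀ᵐ ω ∂P, ContinuousOn (a ω) (closure D) ∧ 0 < aMin D (a ω)) →
      (∀ᵐ ω ∂P, MemL2 D (g ω) ∧ MemL2 D (f ω)) →
      (∀ᵐ ω ∂P, IsMixedSolution D (a ω) (g ω) (f ω) uΓ (q ω) (u ω)) →
      (∀ᵐ ω ∂P, IsHybridSolution 𝒯 (a ω) (g ω) (f ω) uΓ (qh ω) (uh ω) (lam ω)) →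
      ∀ᵐ ω ∂P,
        (∃ γ, 𝒯.IsSkeletonTrace (u ω) γ) ∧
        ∀ γ Pγ Pu, 𝒯.IsSkeletonTrace (u ω) γ → 𝒯.IsFaceProjection γ Pγ →
          𝒯.IsCellProjection (u ω) Pu →
          ∀ T ∈ 𝒯.cells, ∀ E ∈ facesOf T,
            (¬ IsBoundaryFace D E ∨ uΓ =ᵐ[(surf d).restrict (hull E)] 0) →
            normL2 (surf d) (hull E) (fun _ => lam ω E - Pγ E) ≤
              C * ((aMin D (a ω))⁻¹ * √(diamT T) *
                    normL2 volume (elt T) (fun x => q ω x - qh ω T x) +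
                  (√(diamT T))⁻¹ * normL2 volume (elt T) (fun _ => uh ω T - Pu T)) := by
  have hd1 : 1 ≤ d := by omega
  have hd1' : (1 : ℝ) ≤ d := by exact_mod_cast hd1
  -- The maximum with one keeps the constant positive for every real `γ₀`.
  refine ⟨√(d * max γ₀ 1), Real.sqrt_pos.2 (by positivity), ?_⟩
  intro D hD 𝒯 hreg Ω _ P _ a g f uΓ q u qh uh lam ha hgf hmix hhyb
  filter_upwards [ha, hgf, hmix, hhyb] with ω ha hgf hmix hhyb
  obtain ⟨ha, hpos⟩ := ha
  have hg := hgf.1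
  obtain ⟨hu, φ, hφ⟩ := hmix.exists_isSmoothApprox hD.isOpen hD.isBounded ha hpos hg
  obtain ⟨dq, hq, -⟩ := hmix.second
  refine ⟨?_, ?_⟩
  · have htr : ∀ E ∈ 𝒯.faces, ∃ γ, HasTrace D (hull E) (u ω) γ := by
      intro E hE
      obtain ⟨T, hT, hET⟩ := Finset.mem_biUnion.1 hE
      obtain ⟨p, h, ho⟩ := exists_isOpposite hd1 (𝒯.card_eq T hT) (𝒯.indep T hT) hET
      exact ho.exists_hasTrace hD.isBounded hd1 (𝒯.elt_subset hD hT) hu hφ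
    choose! γ hγ using htr
    exact ⟨γ, hγ⟩
  · intro γ Pγ Pu hγ hPγ hPu T hT E hE hb
    have hTc := 𝒯.card_eq T hT
    have hind := 𝒯.indep T hT
    have hTD := 𝒯.elt_subset hD hT
    obtain ⟨p, h, ho⟩ := exists_isOpposite hd1 hTc hind hE
    have hid := multiplier_identity hd1 hD ha hpos hg hq.memL2 hu hhyb hγ hPγ hPu ho hT hE hb
    have hqd : MemL2 D (fun x => q ω x - qh ω T x) := hq.memL2.sub
      (memLp_of_continuous (hhyb.rt T hT).continuous hD.isBounded hD.isBounded.measure_lt_top)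
    have hflux := abs_integral_flux_le hD ha hpos hqd hTD hTc hind ho.mem
    have hvol : volume.real (elt T) = volume.real (hull T) := measureReal_congr (elt_ae_eq_hull T)
    rw [normL2_const, normL2_const, hvol, Real.norm_eq_abs, Real.norm_eq_abs]
    exact multiplier_bound hd1' ho.pos (volume_hull_pos hTc hind) (diamT_pos hd1 hTc hind)
      (le_max_right γ₀ 1) (ho.mul_surf hd1) (ho.diamT_le hd1 hTc hind (hreg T hT))
      (mul_nonneg (inv_nonneg.2 hpos.le) ENNReal.toReal_nonneg) hid hflux rfl
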